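/- Let $M$ be a smooth manifold. A *bundle gerbe* $(P,X,M)$ on $M$ consists of a manifold $X$, a smooth surjection $\pi\colon X\to M$ admitting smooth local sections (every point of $M$ has an open neighbourhood over which $\pi$ has a smooth section), a principal $\mathbb C^\times$-bundle $P\to X^{[2]}=X\times_M X$, and an isomorphism of $\mathbb C^\times$-bundles over $X^{[3]}$, given fibrewise by $P_{(x_2,x_3)}\otimes P_{(x_1,x_2)}\to P_{(x_1,x_3)}$ (the *product*), which is associative over $X^{[4]}$. Here $\otimes$ is the contracted product, $*$ denotes the inverse bundle, and fibre products carry the smooth structure induced from the product manifolds. Let $(P,X,M)$, $(Q,Y,M)$ be bundle gerbes. A *stable morphism* $f\colon P\to Q$ is a trivialisation $(L_f,\phi_f)$ of $P^*\otimes Q$: a $\mathbb C^\times$-bundle $L_f$ on $X\times_M Y$ with an isomorphism $\phi_f\colon\delta(L_f)\to P^*\otimes Q$ over $(X\times_M Y)^{[2]}$, fibrewise $L_f(x_2,y_2)\otimes L_f(x_1,y_1)^*\to P_{(x_1,x_2)}^*\otimes Q_{(y_1,y_2)}$, commuting with the products $(l_3\otimes l_2^*)\otimes(l_2\otimes l_1^*)\mapsto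 l_3\otimes l_1^*$ and $(p^*\otimes q)\otimes(p'^*\otimes q')\mapsto(pp')^*\otimes qq'$. A *transformation* $\theta\colon f\Rightarrow g$ of stable morphisms $P\to Q$ is a smooth section $\theta$ of $L_f^*\otimes L_g$ such that $\delta(\theta)$ is the section of $\delta(L_f^*\otimes L_g)$ corresponding to the isomorphism $\phi_g^{-1}\circ\phi_f\colon\delta(L_f)\to\delta(L_g)$. Transformations compose by the contraction $L_f^*\otimes L_g\otimes L_g^*\otimes L_h\to L_f^*\otimes L_h$; this gives a category $\mathrm{Hom}_s(P,Q)$. **Proposition.** There is a bicategory $\mathcal B_s$ whose objects are the bundle gerbes on $M$ and whose category of 1-arrows and 2-arrows from $P$ to $Q$ is $\mathrm{Hom}_s(P,Q)$, with the following operations. * For $f\colon P\to Q$ and $g\colon Q\to R$, with $R=(R,Z,M)$, the bundle $L_{g\circ f}$ on $X\times_M Z$ is obtained by descent from the bundle on $X\times_M Z\times_M Y^{[2]}$ with fibre $L_f(x,y_1)\otimes L_g(y_2,z)\otimes Q_{(y_1,y_2)}$, and $\phi_{g\circ f}$ is induced by $\phi_f$, $\phi_g$ and the product of $Q$. That is,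 there is an isomorphism $\kappa$ from this bundle to the pullback of $L_{g\circ f}$ such that $\phi_{g\circ f}\bigl(\kappa(a'\otimes b'\otimes q')\otimes\kappa(a\otimes b\otimes q)^*\bigr)=p^*\otimes r$ whenever $\phi_f(a'\otimes a^*)=p^*\otimes s$, $\phi_g(b'\otimes b^*)=t^*\otimes r$ and $q's=tq$. * The identity 1-arrow of $P$ is (up to isomorphism) the bundle $P$ on $X\times_M X$ with $\phi(u_2\otimes u_1^*)=p^*\otimes q$ whenever $u_2p=qu_1$. * In terms of the isomorphisms $\kappa$, the horizontal composite of $\theta\colon f\Rightarrow f'$ and $\rho\colon g\Rightarrow g'$ is $a\otimes b\otimes q\mapsto\theta(a)\otimes\rho(b)\otimes q$, and the associativity isomorphism identifies $(a\otimes b\otimes q)\otimes c\otimes r$ with $a\otimes(b\otimes c\otimes r)\otimes q$ (for a third 1-arrow $h\colon R\to S$, with $c\in L_h(z_2,w)$ and $r\in R_{(z_1,z_2)}$); the identity isomorphisms $f\circ 1_P\cong f$ and $1_Q\circ f\cong f$ are induced by the products and by the actions $L_f(x_2,y)\otimes P_{(x,x_2)}\simeq L_f(x,y)$ and $Q_{(y_1,y)}\otimes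 L_f(x,y_1)\simeq L_f(x,y)$ that $\phi_f$ defines. This bicategory is a bigroupoid: all 2-arrows are invertible, and every 1-arrow $\alpha\colon P\to Q$ is coherently invertible, i.e. there are a 1-arrow $\beta\colon Q\to P$ and 2-arrows $\varphi\colon\beta\circ\alpha\Rightarrow 1_P$, $\psi\colon\alpha\circ\beta\Rightarrow 1_Q$ such that the two 2-arrows $(\alpha\circ\beta)\circ\alpha\Rightarrow\alpha$, one through $\alpha\circ(\beta\circ\alpha)$ and $1_\alpha\circ\varphi$, the other through $\psi\circ 1_\alpha$, are equal. -/

import Mathlib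

open CategoryTheory

universe u v w

/-! ## Bicategories and bigroupoids -/

/-- A bicategory with prescribed objects `Ob` and prescribed categories `Hom A B` of 1-arrows and
2-arrows. The fields are those of Mathlib's `Bicategory`, see `toBicategory`; in particular
`comp f g` is the composite "first `f`, then `g`". -/
structure BicategoryOn {Ob : Type u} (Hom : Ob → Ob → Type v) [∀ A B, Category.{w} (Hom A B)] where
  id (a : Ob) : Hom a a
  comp {a b c : Ob} (f : Hom a b) (g : Hom b c) : Hom a c
  whiskerLeft {a b c : Ob} (f : Hom a b) {g h : Hom b c} (η : g ⟶ h) : comp f g ⟶ comp f h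
  whiskerRight {a b c : Ob} {f g : Hom a b} (η : f ⟶ g) (h : Hom b c) : comp f h ⟶ comp g h
  associator {a b c d : Ob} (f : Hom a b) (g : Hom b c) (h : Hom c d) :
    comp (comp f g) h ≅ comp f (comp g h)
  leftUnitor {a b : Ob} (f : Hom a b) : comp (id a) f ≅ f
  rightUnitor {a b : Ob} (f : Hom a b) : comp f (id b) ≅ f
  whiskerLeft_id {a b c : Ob} (f : Hom a b) (g : Hom b c) : whiskerLeft f (𝟙 g) = 𝟙 (comp f g)
  whiskerLeft_comp {a b c : Ob} (f : Hom a b) {g h i : Hom b c} (η : g ⟶ h) (θ : h ⟶ i) :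
    whiskerLeft f (η ≫ θ) = whiskerLeft f η ≫ whiskerLeft f θ
  id_whiskerLeft {a b : Ob} {f g : Hom a b} (η : f ⟶ g) :
    whiskerLeft (id a) η = (leftUnitor f).hom ≫ η ≫ (leftUnitor g).inv
  comp_whiskerLeft {a b c d : Ob} (f : Hom a b) (g : Hom b c) {h h' : Hom c d} (η : h ⟶ h') :
    whiskerLeft (comp f g) η =
      (associator f g h).hom ≫ whiskerLeft f (whiskerLeft g η) ≫ (associator f g h').inv
  id_whiskerRight {a b c : Ob} (f : Hom a b) (g : Hom b c) : whiskerRight (𝟙 f) g = 𝟙 (comp f g)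
  comp_whiskerRight {a b c : Ob} {f g h : Hom a b} (η : f ⟶ g) (θ : g ⟶ h) (i : Hom b c) :
    whiskerRight (η ≫ θ) i = whiskerRight η i ≫ whiskerRight θ i
  whiskerRight_id {a b : Ob} {f g : Hom a b} (η : f ⟶ g) :
    whiskerRight η (id b) = (rightUnitor f).hom ≫ η ≫ (rightUnitor g).inv
  whiskerRight_comp {a b c d : Ob} {f f' : Hom a b} (η : f ⟶ f') (g : Hom b c) (h : Hom c d) :
    whiskerRight η (comp g h) =
      (associator f g h).inv ≫ whiskerRight (whiskerRight η g) h ≫ (associator f' g h).hom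
  whisker_assoc {a b c d : Ob} (f : Hom a b) {g g' : Hom b c} (η : g ⟶ g') (h : Hom c d) :
    whiskerRight (whiskerLeft f η) h =
      (associator f g h).hom ≫ whiskerLeft f (whiskerRight η h) ≫ (associator f g' h).inv
  whisker_exchange {a b c : Ob} {f g : Hom a b} {h i : Hom b c} (η : f ⟶ g) (θ : h ⟶ i) :
    whiskerLeft f θ ≫ whiskerRight η i = whiskerRight η h ≫ whiskerLeft g θ
  pentagon {a b c d e : Ob} (f : Hom a b) (g : Hom b c) (h : Hom c d) (i : Hom d e) :
    whiskerRight (associator f g h).hom i ≫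
        (associator f (comp g h) i).hom ≫ whiskerLeft f (associator g h i).hom =
      (associator (comp f g) h i).hom ≫ (associator f g (comp h i)).hom
  triangle {a b c : Ob} (f : Hom a b) (g : Hom b c) :
    (associator f (id b) g).hom ≫ whiskerLeft f (leftUnitor g).hom =
      whiskerRight (rightUnitor f).hom g

/-- The underlying bicategory in Mathlib's sense. -/
abbrev BicategoryOn.toBicategory {Ob : Type u} {Hom : Ob → Ob → Type v}
    [inst : ∀ A B, Category.{w} (Hom A B)] (𝔅 : BicategoryOn Hom) : Bicategory Ob where
  Hom := Hom
  id := 𝔅.id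
  comp := 𝔅.comp
  homCategory := inst
  whiskerLeft := 𝔅.whiskerLeft
  whiskerRight := 𝔅.whiskerRight
  associator := 𝔅.associator
  leftUnitor := 𝔅.leftUnitor
  rightUnitor := 𝔅.rightUnitor
  whiskerLeft_id := 𝔅.whiskerLeft_id
  whiskerLeft_comp := 𝔅.whiskerLeft_comp
  id_whiskerLeft := 𝔅.id_whiskerLeft
  comp_whiskerLeft := 𝔅.comp_whiskerLeft
  id_whiskerRight := 𝔅.id_whiskerRight
  comp_whiskerRight := 𝔅.comp_whiskerRight
  whiskerRight_id := 𝔅.whiskerRight_id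
  whiskerRight_comp := 𝔅.whiskerRight_comp
  whisker_assoc := 𝔅.whisker_assoc
  whisker_exchange := 𝔅.whisker_exchange
  pentagon := 𝔅.pentagon
  triangle := 𝔅.triangle

open Bicategory in
/-- A bicategory is a bigroupoid if its 2-arrows are invertible and its 1-arrows are coherently
invertible. -/
def IsBigroupoid (Ob : Type u) [Bicategory.{w, v} Ob] : Prop :=
  (∀ (a b : Ob) (f g : a ⟶ b) (η : f ⟶ g), IsIso η) ∧
  ∀ (a b : Ob) (f : a ⟶ b), ∃ (g : b ⟶ a) (φ : f ≫ g ⟶ 𝟙 a) (ψ : g ≫ f ⟶ 𝟙 b),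
    (α_ f g f).inv ≫ φ ▷ f ≫ (λ_ f).hom = f ◁ ψ ≫ (ρ_ f).hom

open scoped Manifold ContDiff Topology

/-! ## `ℂˣ`-torsors: inverse and contracted product -/

/-- The inverse `A*` of a `ℂˣ`-torsor `A`: the same set, whose points are written `dstar a`, on which
`ℂˣ` acts through `z ↦ z⁻¹`. -/
structure DualTorsor (A : Type u) : Type u where
  /-- the point `a*` of `A*` given by a point `a` of `A` -/
  dstar ::
  /-- the point of `A` underlying a point of `A*` -/
  undstar : A

namespace DualTorsor

variable {A : Type u} [Torsor ℂˣ A]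

instance : MulAction ℂˣ (DualTorsor A) where
  smul c a := dstar (c⁻¹ • a.undstar)
  one_smul a := by
    change dstar ((1 : ℂˣ)⁻¹ • a.undstar) = a
    rw [inv_one, one_smul]
  mul_smul c d a := by
    change dstar ((c * d)⁻¹ • a.undstar) = dstar (c⁻¹ • (d⁻¹ • a.undstar))
    rw [mul_inv, mul_smul]

instance : Torsor ℂˣ (DualTorsor A) where
  sdiv a b := b.undstar /ₛ a.undstar
  nonempty := ⟨dstar (Classical.arbitrary A)⟩
  sdiv_smul' a b := by
    change dstar ((b.undstar /ₛ a.undstar)⁻¹ • b.undstar) = a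
    rw [inv_sdiv_eq_sdiv_rev, sdiv_smul]
  smul_sdiv' c a := by
    change a.undstar /ₛ (c⁻¹ • a.undstar) = c
    rw [sdiv_smul_eq_sdiv_div, sdiv_self, one_div, inv_inv]

theorem smul_dstar (c : ℂˣ) (a : A) : c • dstar a = dstar (c⁻¹ • a) := rfl

theorem dstar_sdiv_dstar (a b : A) : dstar a /ₛ dstar b = b /ₛ a := rfl

end DualTorsor

/-- `(a, b)` and `(a', b')` are identified in the contracted product when they differ by an
antidiagonal element `(c, c⁻¹)` of `ℂˣ × ℂˣ`. -/
def tensorSetoid (A B : Type u) [Torsor ℂˣ A] [Torsor ℂˣ B] : Setoid (A × B) where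
  r p q := ∃ c : ℂˣ, q.1 = c • p.1 ∧ q.2 = c⁻¹ • p.2
  iseqv :=
    { refl := fun p => ⟨1, by simp⟩
      symm := by
        rintro p q ⟨c, h1, h2⟩
        exact ⟨c⁻¹, by rw [h1, inv_smul_smul], by rw [h2, inv_inv, smul_inv_smul]⟩
      trans := by
        rintro p q r ⟨c, h1, h2⟩ ⟨d, h3, h4⟩
        exact ⟨d * c, by rw [h3, h1, mul_smul], by rw [h4, h2, mul_inv, mul_smul]⟩ }

/-- The contracted product `A ⊗ B` of two `ℂˣ`-torsors. -/
def TensorTorsor (A B : Type u) [Torsor ℂˣ A] [Torsor ℂˣ B] : Type u :=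
  Quotient (tensorSetoid A B)

namespace TensorTorsor

variable {A B C : Type u} [Torsor ℂˣ A] [Torsor ℂˣ B] [Torsor ℂˣ C]

/-- The element `a ⊗ b` of the contracted product. -/
def tmul (a : A) (b : B) : TensorTorsor A B := Quotient.mk (tensorSetoid A B) (a, b)

theorem exists_tmul (t : TensorTorsor A B) : ∃ a b, t = tmul a b :=
  Quotient.inductionOn t fun p => ⟨p.1, p.2, rfl⟩

theorem tmul_eq_iff {a a' : A} {b b' : B} :
    tmul a b = tmul a' b' ↔ ∃ c : ℂˣ, a' = c • a ∧ b' = c⁻¹ • b :=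
  @Quotient.eq _ (tensorSetoid A B) _ _

theorem smul_tmul_inv_smul (c : ℂˣ) (a : A) (b : B) : tmul (c • a) (c⁻¹ • b) = tmul a b :=
  (tmul_eq_iff.2 ⟨c, rfl, rfl⟩).symm

theorem smul_tmul_eq (c : ℂˣ) (a : A) (b : B) : tmul (c • a) b = tmul a (c • b) :=
  tmul_eq_iff.2 ⟨c⁻¹, by simp, by simp⟩

instance : MulAction ℂˣ (TensorTorsor A B) where
  smul c := Quotient.map (sa := tensorSetoid A B) (sb := tensorSetoid A B)
    (fun p => (c • p.1, p.2)) (by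
      rintro p q ⟨d, h1, h2⟩
      exact ⟨d, by simp only [h1]; exact smul_comm _ _ _, h2⟩)
  one_smul t := by
    obtain ⟨a, b, rfl⟩ := exists_tmul t
    exact congrArg (fun x => tmul x b) (one_smul ℂˣ a)
  mul_smul c d t := by
    obtain ⟨a, b, rfl⟩ := exists_tmul t
    exact congrArg (fun x => tmul x b) (mul_smul c d a)

theorem smul_tmul (c : ℂˣ) (a : A) (b : B) : c • tmul a b = tmul (c • a) b := rfl

instance : Torsor ℂˣ (TensorTorsor A B) where
  sdiv s t := Quotient.liftOn₂ (s₁ := tensorSetoid A B) (s₂ := tensorSetoid A B) s t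
    (fun p q => (p.1 /ₛ q.1) * (p.2 /ₛ q.2)) (by
      rintro p q p' q' ⟨c, h1, h2⟩ ⟨d, h3, h4⟩
      rw [h1, h2, h3, h4]
      simp only [smul_sdiv_assoc, sdiv_smul_eq_sdiv_div, div_eq_mul_inv, inv_inv]
      rw [show c * (p.1 /ₛ q.1) * d⁻¹ * (c⁻¹ * (p.2 /ₛ q.2) * d) =
        (c * c⁻¹) * (d * d⁻¹) * ((p.1 /ₛ q.1) * (p.2 /ₛ q.2)) by ac_rfl]
      simp)
  nonempty := ⟨tmul (Classical.arbitrary A) (Classical.arbitrary B)⟩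
  sdiv_smul' s t := by
    obtain ⟨a, b, rfl⟩ := exists_tmul s
    obtain ⟨a', b', rfl⟩ := exists_tmul t
    change tmul (((a /ₛ a') * (b /ₛ b')) • a') b' = tmul a b
    rw [mul_comm, mul_smul, sdiv_smul, smul_tmul_eq, sdiv_smul]
  smul_sdiv' c t := by
    obtain ⟨a, b, rfl⟩ := exists_tmul t
    change ((c • a) /ₛ a) * (b /ₛ b) = c
    rw [smul_sdiv, sdiv_self, mul_one]

theorem tmul_sdiv_tmul (a a' : A) (b b' : B) :
    tmul a b /ₛ tmul a' b' = (a /ₛ a') * (b /ₛ b') := rfl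

theorem tmul_left_cancel {a : A} {b b' : B} (h : tmul a b = tmul a b') : b = b' := by
  have := congrArg (fun t => t /ₛ tmul a b') h
  simpa [tmul_sdiv_tmul] using this

theorem exists_right (t : TensorTorsor A B) (a : A) : ∃ b, t = tmul a b := by
  obtain ⟨a', b, rfl⟩ := exists_tmul t
  exact ⟨(a' /ₛ a) • b, by rw [← smul_tmul_eq, sdiv_smul]⟩

/-- The canonical element `a* ⊗ a` of `A* ⊗ A`, which does not depend on `a`. -/
noncomputable def coev (A : Type u) [Torsor ℂˣ A] : TensorTorsor (DualTorsor A) A :=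
  tmul (.dstar (Classical.arbitrary A)) (Classical.arbitrary A)

theorem coev_eq (a : A) : coev A = tmul (.dstar a) a :=
  tmul_eq_iff.2 ⟨Classical.arbitrary A /ₛ a, by
    rw [DualTorsor.smul_dstar, inv_sdiv_eq_sdiv_rev, sdiv_smul], by
    rw [inv_sdiv_eq_sdiv_rev, sdiv_smul]⟩

/-- The contraction `(A* ⊗ B) ⊗ (B* ⊗ C) → A* ⊗ C`, which sends `(a ⊗ b) ⊗ (b'* ⊗ c)` to
`(b / b') • (a ⊗ c)`. -/
def contract (s : TensorTorsor A B) (t : TensorTorsor (DualTorsor B) C) : TensorTorsor A C :=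
  Quotient.liftOn₂ (s₁ := tensorSetoid A B) (s₂ := tensorSetoid (DualTorsor B) C) s t
    (fun p q => (p.2 /ₛ q.1.undstar) • tmul p.1 q.2) (by
      rintro ⟨a, b⟩ ⟨⟨b'⟩, c⟩ ⟨a₁, b₁⟩ ⟨⟨b₁'⟩, c₁⟩ ⟨x, h1, h2⟩ ⟨y, h3, h4⟩
      rw [DualTorsor.smul_dstar, DualTorsor.dstar.injEq] at h3
      simp only at h1 h2 h3 h4 ⊢
      subst h1 h2 h3 h4
      rw [smul_sdiv_assoc, sdiv_smul_eq_sdiv_div, smul_tmul, smul_tmul, ← smul_tmul_eq,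
        ← mul_smul, ← mul_smul]
      congr 2
      rw [div_inv_eq_mul, show y⁻¹ * (x⁻¹ * ((b /ₛ b') * y)) * x =
        (y * y⁻¹) * (x * x⁻¹) * (b /ₛ b') by ac_rfl]
      simp)

theorem contract_tmul (a : A) (b : B) (c : C) :
    contract (tmul a b) (tmul (.dstar b) c) = tmul a c := by
  change (b /ₛ b) • tmul a c = _
  rw [sdiv_self, one_smul]

end TensorTorsor

open DualTorsor TensorTorsor

/-! ## Smooth functions on subsets of manifolds -/

section Bundles

variable {E H N : Type u} [NormedAddCommGroup E] [NormedSpace ℝ E] [TopologicalSpace H]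
  (I : ModelWithCorners ℝ E H) [TopologicalSpace N] [ChartedSpace H N]

/-- A `ℂˣ`-valued function on a subset `S` of a manifold `N` is smooth at `p` if near `p` it is the
restriction of a smooth function on `N`. If `S` is an embedded submanifold of `N` this is
smoothness for the manifold structure of `S`. -/
def SmoothAtOn (S : Set N) (f : S → ℂˣ) (p : S) : Prop :=
  ∃ g : N → ℂ, (∀ᶠ q in 𝓝 (p : N), ContMDiffAt I 𝓘(ℝ, ℂ) ∞ g q) ∧
    ∀ᶠ q in 𝓝 p, (f q : ℂ) = g q

variable {I}

theorem SmoothAtOn.mul {S : Set N} {f f' : S → ℂˣ} {p : S} (h : SmoothAtOn I S f p)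
    (h' : SmoothAtOn I S f' p) : SmoothAtOn I S (fun q => f q * f' q) p := by
  obtain ⟨g, hg, hfg⟩ := h
  obtain ⟨g', hg', hfg'⟩ := h'
  refine ⟨fun q => g q * g' q, ?_, ?_⟩
  · filter_upwards [hg, hg'] with q h1 h2
    exact (contDiff_mul (𝕜 := ℝ) (𝔸 := ℂ)).contMDiff.contMDiffAt.comp q (h1.prodMk_space h2)
  · filter_upwards [hfg, hfg'] with q h1 h2
    rw [Units.val_mul, h1, h2]

theorem SmoothAtOn.congr {S : Set N} {f f' : S → ℂˣ} {p : S} (h : SmoothAtOn I S f p)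
    (e : ∀ q, f q = f' q) : SmoothAtOn I S f' p :=
  (funext e : f = f') ▸ h

/-! ## Principal `ℂˣ`-bundles -/

variable (I)

/-- A smooth principal `ℂˣ`-bundle over a subset `S` of a manifold: a family of `ℂˣ`-torsors with an
open cover `U` of `S` and, for each member of the cover, a section of the family over it, any two of
which differ by a smooth transition function. The section `sec i` is written as a family on all
of `S`; its values outside `U i` play no role. The total space carries the unique smooth structure
for which the maps `U i × ℂˣ → Fib`, `(b, z) ↦ z • sec i b`, are local trivialisations. -/
structure CBundle (S : Set N) where
  /-- the fibres -/
  Fib : S → Type u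
  [torsor : ∀ b, Torsor ℂˣ (Fib b)]
  /-- the index set of the trivialising cover -/
  Idx : Type u
  /-- the trivialising cover -/
  U : Idx → Set S
  isOpen_U : ∀ i, IsOpen (U i)
  cover : ∀ b, ∃ i, b ∈ U i
  /-- the trivialising local sections -/
  sec : Idx → ∀ b, Fib b
  smooth_transition : ∀ i j b, b ∈ U i → b ∈ U j →
    SmoothAtOn I S (fun q => sec i q /ₛ sec j q) b

attribute [instance] CBundle.torsor

namespace CBundle

variable {I} {S : Set N}

/-- A smooth section of a `ℂˣ`-bundle. -/
@[ext]
structure Sect (L : CBundle I S) where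
  val : ∀ b, L.Fib b
  smooth : ∀ i b, b ∈ L.U i → SmoothAtOn I S (fun q => val q /ₛ L.sec i q) b

/-- A smooth isomorphism of `ℂˣ`-bundles covering the identity: a smooth `ℂˣ`-equivariant map. It is
bijective because the fibres are torsors. -/
@[ext]
structure Iso (L L' : CBundle I S) where
  map : ∀ b, L.Fib b → L'.Fib b
  map_smul : ∀ b (c : ℂˣ) l, map b (c • l) = c • map b l
  smooth : ∀ i j b, b ∈ L.U i → b ∈ L'.U j →
    SmoothAtOn I S (fun q => map q (L.sec i q) /ₛ L'.sec j q) b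

/-- The inverse bundle `L*`. -/
abbrev dual (L : CBundle I S) : CBundle I S where
  Fib b := DualTorsor (L.Fib b)
  Idx := L.Idx
  U := L.U
  isOpen_U := L.isOpen_U
  cover := L.cover
  sec i b := dstar (L.sec i b)
  smooth_transition i j b hi hj := L.smooth_transition j i b hj hi

/-- The contracted product `L ⊗ L'`. -/
abbrev tensor (L L' : CBundle I S) : CBundle I S where
  Fib b := TensorTorsor (L.Fib b) (L'.Fib b)
  Idx := L.Idx × L'.Idx
  U i := L.U i.1 ∩ L'.U i.2
  isOpen_U i := (L.isOpen_U i.1).inter (L'.isOpen_U i.2)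
  cover b := by
    obtain ⟨i, hi⟩ := L.cover b
    obtain ⟨j, hj⟩ := L'.cover b
    exact ⟨(i, j), hi, hj⟩
  sec i b := tmul (L.sec i.1 b) (L'.sec i.2 b)
  smooth_transition i j b hi hj :=
    (L.smooth_transition i.1 j.1 b hi.1 hj.1).mul (L'.smooth_transition i.2 j.2 b hi.2 hj.2)

variable {E' H' N' : Type u} [NormedAddCommGroup E'] [NormedSpace ℝ E'] [TopologicalSpace H']
  {I' : ModelWithCorners ℝ E' H'} [TopologicalSpace N'] [ChartedSpace H' N']

/-- The pullback of a `ℂˣ`-bundle along the map `S' → S` that is the restriction of a smooth map `K`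
of the ambient manifolds. -/
abbrev pullback (L : CBundle I S) (S' : Set N') (K : N' → N) (hK : ContMDiff I' I ∞ K)
    (hS : ∀ p ∈ S', K p ∈ S) : CBundle I' S' where
  Fib p := L.Fib ⟨K p, hS p p.2⟩
  Idx := L.Idx
  U i := {p | (⟨K p, hS p p.2⟩ : S) ∈ L.U i}
  isOpen_U i := (L.isOpen_U i).preimage (f := fun p : S' => (⟨K p, hS p p.2⟩ : S))
    ((hK.continuous.comp continuous_subtype_val).subtype_mk fun p => hS p p.2)
  cover p := L.cover ⟨K p, hS p p.2⟩
  sec i p := L.sec i ⟨K p, hS p p.2⟩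
  smooth_transition i j p hi hj := by
    obtain ⟨g, hg, hfg⟩ := L.smooth_transition i j _ hi hj
    have hc : Continuous fun q : S' => (⟨K q, hS q q.2⟩ : S) :=
      (hK.continuous.comp continuous_subtype_val).subtype_mk fun p => hS p p.2
    refine ⟨fun q => g (K q), ?_, ?_⟩
    · filter_upwards [hK.continuous.continuousAt.eventually hg] with q hq
      exact hq.comp q hK.contMDiffAt
    · exact hc.continuousAt.eventually hfg

end CBundle

end Bundles

/-! ## Bundle gerbes -/

noncomputable section Gerbes

variable (E M : Type u) [NormedAddCommGroup E] [NormedSpace ℝ E] [TopologicalSpace M]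
  [ChartedSpace E M]

/-- A smooth (Hausdorff, paracompact, possibly infinite-dimensional) manifold `X` with a smooth
surjection `π : X → M` that admits smooth local sections. -/
structure LocallySplit where
  X : Type u
  V : Type u
  [normedAddCommGroup : NormedAddCommGroup V]
  [normedSpace : NormedSpace ℝ V]
  [completeSpace : CompleteSpace V]
  [topologicalSpace : TopologicalSpace X]
  [t2Space : T2Space X]
  [paracompactSpace : ParacompactSpace X]
  [chartedSpace : ChartedSpace V X]
  [isManifold : IsManifold 𝓘(ℝ, V) ∞ X]
  π : X → M
  smooth_π : ContMDiff 𝓘(ℝ, V) 𝓘(ℝ, E) ∞ π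
  surjective_π : Function.Surjective π
  exists_localSection : ∀ m : M, ∃ (U : Set M) (σ : M → X), IsOpen U ∧ m ∈ U ∧
    ContMDiffOn 𝓘(ℝ, E) 𝓘(ℝ, V) ∞ σ U ∧ ∀ m' ∈ U, π (σ m') = m'

attribute [instance] LocallySplit.normedAddCommGroup LocallySplit.normedSpace
  LocallySplit.completeSpace LocallySplit.topologicalSpace LocallySplit.t2Space
  LocallySplit.paracompactSpace LocallySplit.chartedSpace LocallySplit.isManifold

variable {E M}

namespace LocallySplit

/-- The model with corners of `X`. -/
abbrev I (A : LocallySplit E M) : ModelWithCorners ℝ A.V A.V := 𝓘(ℝ, A.V)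

/-- The fibre product `X ×_M Y`. -/
def fp (A B : LocallySplit E M) : Set (A.X × B.X) := {p | A.π p.1 = B.π p.2}

/-- The triple fibre product `X^[3]`. -/
def fp3 (A : LocallySplit E M) : Set (A.X × A.X × A.X) :=
  {p | A.π p.1 = A.π p.2.1 ∧ A.π p.2.1 = A.π p.2.2}

/-- `(X ×_M Y)^[2]`, the set of pairs `((x₁, y₁), (x₂, y₂))` over one point of `M`. -/
def fpSq (A B : LocallySplit E M) : Set ((A.X × B.X) × (A.X × B.X)) :=
  {p | A.π p.1.1 = B.π p.1.2 ∧ A.π p.2.1 = B.π p.2.2 ∧ A.π p.1.1 = A.π p.2.1}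

/-- `X ×_M Z ×_M Y^[2]`, the set of quadruples `(x, z, y₁, y₂)` over one point of `M`. -/
def fpComp (A B C : LocallySplit E M) : Set (A.X × C.X × B.X × B.X) :=
  {p | A.π p.1 = B.π p.2.2.1 ∧ B.π p.2.2.1 = B.π p.2.2.2 ∧ B.π p.2.2.2 = C.π p.2.1}

end LocallySplit

variable (E M) in
/-- A bundle gerbe `(P, X, M)`: a `ℂˣ`-bundle `P` on `X^[2]` with an associative product
`P_(x₂, x₃) ⊗ P_(x₁, x₂) → P_(x₁, x₃)`. -/
structure BundleGerbe extends LocallySplit E M where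
  P : CBundle (toLocallySplit.I.prod toLocallySplit.I) (toLocallySplit.fp toLocallySplit)
  /-- the isomorphism `π₁⁻¹ P ⊗ π₃⁻¹ P → π₂⁻¹ P` over `X^[3]`, where `πᵢ` omits the `i`-th factor -/
  product : CBundle.Iso (I := toLocallySplit.I.prod (toLocallySplit.I.prod toLocallySplit.I))
    ((P.pullback toLocallySplit.fp3 (fun p => p.2) contMDiff_snd fun _ h => h.2).tensor
      (P.pullback toLocallySplit.fp3 (fun p => (p.1, p.2.1))
        (contMDiff_fst.prodMk (contMDiff_fst.comp contMDiff_snd)) fun _ h => h.1))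
    (P.pullback toLocallySplit.fp3 (fun p => (p.1, p.2.2))
        (contMDiff_fst.prodMk (contMDiff_snd.comp contMDiff_snd)) fun _ h => h.1.trans h.2)
  product_assoc : ∀ (x₁ x₂ x₃ x₄ : X) (h₁₂ : π x₁ = π x₂) (h₂₃ : π x₂ = π x₃) (h₃₄ : π x₃ = π x₄)
    (s : P.Fib ⟨(x₃, x₄), h₃₄⟩) (t : P.Fib ⟨(x₂, x₃), h₂₃⟩) (r : P.Fib ⟨(x₁, x₂), h₁₂⟩),
    product.map ⟨(x₁, x₂, x₄), h₁₂, h₂₃.trans h₃₄⟩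
        (tmul (product.map ⟨(x₂, x₃, x₄), h₂₃, h₃₄⟩ (tmul s t)) r) =
      product.map ⟨(x₁, x₃, x₄), h₁₂.trans h₂₃, h₃₄⟩
        (tmul s (product.map ⟨(x₁, x₂, x₃), h₁₂, h₂₃⟩ (tmul t r)))

namespace BundleGerbe

/-- The fibre `P_(x₁, x₂)`. -/
abbrev fib (G : BundleGerbe E M) {x₁ x₂ : G.X} (h : G.π x₁ = G.π x₂) : Type u :=
  G.P.Fib ⟨(x₁, x₂), h⟩

/-- The product `P_(x₂, x₃) ⊗ P_(x₁, x₂) → P_(x₁, x₃)` on elements. -/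
def mul (G : BundleGerbe E M) {x₁ x₂ x₃ : G.X} {h₁₂ : G.π x₁ = G.π x₂} {h₂₃ : G.π x₂ = G.π x₃}
    (s : G.fib h₂₃) (t : G.fib h₁₂) : G.fib (h₁₂.trans h₂₃) :=
  G.product.map ⟨(x₁, x₂, x₃), h₁₂, h₂₃⟩ (tmul s t)

end BundleGerbe

/-! ## Stable morphisms and transformations -/

/-- `δ(L)` over `(X ×_M Y)^[2]`, with fibre `L_(x₂, y₂) ⊗ L_(x₁, y₁)*` at
`((x₁, y₁), (x₂, y₂))`. -/
abbrev delta {A B : LocallySplit E M} (L : CBundle (A.I.prod B.I) (A.fp B)) :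
    CBundle ((A.I.prod B.I).prod (A.I.prod B.I)) (A.fpSq B) :=
  (L.pullback (A.fpSq B) (fun p => p.2) contMDiff_snd fun _ h => h.2.1).tensor
    (L.pullback (A.fpSq B) (fun p => p.1) contMDiff_fst fun _ h => h.1).dual

/-- The `ℂˣ`-bundle `P* ⊗ Q` over `(X ×_M Y)^[2]`, with fibre `P_(x₁, x₂)* ⊗ Q_(y₁, y₂)` at
`((x₁, y₁), (x₂, y₂))`. -/
abbrev dualTensor (G K : BundleGerbe E M) :
    CBundle ((G.I.prod K.I).prod (G.I.prod K.I)) (G.fpSq K.toLocallySplit) :=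
  (G.P.pullback (G.fpSq K.toLocallySplit) (fun p => (p.1.1, p.2.1))
      ((contMDiff_fst.comp contMDiff_fst).prodMk (contMDiff_fst.comp contMDiff_snd))
      fun _ h => h.2.2).dual.tensor
    (K.P.pullback (G.fpSq K.toLocallySplit) (fun p => (p.1.2, p.2.2))
      ((contMDiff_snd.comp contMDiff_fst).prodMk (contMDiff_snd.comp contMDiff_snd))
      fun _ h => h.1.symm.trans (h.2.2.trans h.2.1))

/-- A stable morphism `P → Q`: a trivialisation `(L, φ)` of the bundle gerbe `P* ⊗ Q`, that is, a
`ℂˣ`-bundle `L` on `X ×_M Y` with an isomorphism `φ : δ(L) → P* ⊗ Q` that commutes with the bundle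
gerbe products. The product of `δ(L)` sends `(l₃ ⊗ l₂*) ⊗ (l₂ ⊗ l₁*)` to `l₃ ⊗ l₁*`; the product of
`P* ⊗ Q` sends `(p* ⊗ q) ⊗ (p'* ⊗ q')` to `(p p')* ⊗ (q q')`. -/
structure StableMorphism (G K : BundleGerbe E M) where
  L : CBundle (G.I.prod K.I) (G.fp K.toLocallySplit)
  φ : CBundle.Iso (delta L) (dualTensor G K)
  φ_mul : ∀ (x₁ x₂ x₃ : G.X) (y₁ y₂ y₃ : K.X) (h₁ : G.π x₁ = K.π y₁) (h₂ : G.π x₂ = K.π y₂)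
    (h₃ : G.π x₃ = K.π y₃) (hx₁₂ : G.π x₁ = G.π x₂) (hx₂₃ : G.π x₂ = G.π x₃)
    (hy₁₂ : K.π y₁ = K.π y₂) (hy₂₃ : K.π y₂ = K.π y₃)
    (l₁ : L.Fib ⟨(x₁, y₁), h₁⟩) (l₂ : L.Fib ⟨(x₂, y₂), h₂⟩) (l₃ : L.Fib ⟨(x₃, y₃), h₃⟩)
    (p : G.fib hx₂₃) (p' : G.fib hx₁₂) (q : K.fib hy₂₃) (q' : K.fib hy₁₂),
    φ.map ⟨((x₂, y₂), (x₃, y₃)), h₂, h₃, hx₂₃⟩ (tmul l₃ (dstar l₂)) = tmul (dstar p) q →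
    φ.map ⟨((x₁, y₁), (x₂, y₂)), h₁, h₂, hx₁₂⟩ (tmul l₂ (dstar l₁)) = tmul (dstar p') q' →
    φ.map ⟨((x₁, y₁), (x₃, y₃)), h₁, h₃, hx₁₂.trans hx₂₃⟩ (tmul l₃ (dstar l₁)) =
      tmul (dstar (G.mul p p')) (K.mul q q')

namespace StableMorphism

variable {G K : BundleGerbe E M}

/-- The fibre `L_(x, y)`. -/
abbrev fib (f : StableMorphism G K) {x : G.X} {y : K.X} (h : G.π x = K.π y) : Type u :=
  f.L.Fib ⟨(x, y), h⟩

/-- The value `φ(l₂ ⊗ l₁*)` in `P_(x₁, x₂)* ⊗ Q_(y₁, y₂)`. -/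
def phi (f : StableMorphism G K) {x₁ x₂ : G.X} {y₁ y₂ : K.X} {h₁ : G.π x₁ = K.π y₁}
    {h₂ : G.π x₂ = K.π y₂} (hx : G.π x₁ = G.π x₂) (l₂ : f.fib h₂) (l₁ : f.fib h₁) :
    TensorTorsor (DualTorsor (G.fib hx)) (K.fib (h₁.symm.trans (hx.trans h₂))) :=
  f.φ.map ⟨((x₁, y₁), (x₂, y₂)), h₁, h₂, hx⟩ (tmul l₂ (dstar l₁))

/-- A transformation `f ⇒ g`: a smooth section `θ` of `L_f* ⊗ L_g` with `δ(θ) = φ̂_(f,g)`, where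
`φ̂_(f,g)` is the section of `δ(L_f* ⊗ L_g)` that corresponds to the isomorphism
`φ_g⁻¹ ∘ φ_f : δ(L_f) → δ(L_g)`. If `θ = l₁* ⊗ k₁` at the first point and `θ = l₂* ⊗ k₂` at the
second, the equation says that this isomorphism sends `l₂ ⊗ l₁*` to `k₂ ⊗ k₁*`. -/
@[ext]
structure Transformation (f g : StableMorphism G K) where
  θ : (f.L.dual.tensor g.L).Sect
  compat : ∀ (x₁ x₂ : G.X) (y₁ y₂ : K.X) (h₁ : G.π x₁ = K.π y₁) (h₂ : G.π x₂ = K.π y₂)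
    (hx : G.π x₁ = G.π x₂) (l₁ : f.fib h₁) (l₂ : f.fib h₂) (k₁ : g.fib h₁) (k₂ : g.fib h₂),
    θ.val ⟨(x₁, y₁), h₁⟩ = tmul (dstar l₁) k₁ → θ.val ⟨(x₂, y₂), h₂⟩ = tmul (dstar l₂) k₂ →
    f.phi hx l₂ l₁ = g.phi hx k₂ k₁

/-- The identity transformation, with value `l* ⊗ l`. -/
def Transformation.id (f : StableMorphism G K) : Transformation f f where
  θ :=
    { val := fun b => coev (f.L.Fib b)
      smooth := by
        rintro ⟨i, j⟩ b ⟨hi, hj⟩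
        refine (f.L.smooth_transition i j b hi hj).congr fun q => ?_
        change _ = coev (f.L.Fib q) /ₛ tmul (dstar (f.L.sec i q)) (f.L.sec j q)
        rw [coev_eq (f.L.sec i q), tmul_sdiv_tmul, sdiv_self, one_mul] }
  compat x₁ x₂ y₁ y₂ h₁ h₂ hx l₁ l₂ k₁ k₂ e₁ e₂ := by
    replace e₁ : coev (f.fib h₁) = tmul (dstar l₁) k₁ := e₁
    replace e₂ : coev (f.fib h₂) = tmul (dstar l₂) k₂ := e₂
    rw [coev_eq l₁] at e₁
    rw [coev_eq l₂] at e₂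
    rw [tmul_left_cancel e₁, tmul_left_cancel e₂]

/-- The composite transformation, given by contraction
`L_f* ⊗ L_g ⊗ L_g* ⊗ L_h → L_f* ⊗ L_h`. -/
def Transformation.comp {f g h : StableMorphism G K} (s : Transformation f g)
    (t : Transformation g h) : Transformation f h where
  θ :=
    { val := fun b => contract (s.θ.val b) (t.θ.val b)
      smooth := by
        rintro ⟨i, j⟩ b ⟨hi, hj⟩
        obtain ⟨k, hk⟩ := g.L.cover b
        refine ((s.θ.smooth (i, k) b ⟨hi, hk⟩).mul (t.θ.smooth (k, j) b ⟨hk, hj⟩)).congr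
          fun q => ?_
        obtain ⟨a, ha⟩ := exists_right (s.θ.val q) (dstar (f.L.sec i q))
        obtain ⟨c, hc⟩ := exists_right (t.θ.val q) (dstar a)
        rw [ha, hc, contract_tmul]
        change (dstar (f.L.sec i q) /ₛ dstar (f.L.sec i q)) * (a /ₛ g.L.sec k q) *
            ((dstar a /ₛ dstar (g.L.sec k q)) * (c /ₛ h.L.sec j q)) =
          (dstar (f.L.sec i q) /ₛ dstar (f.L.sec i q)) * (c /ₛ h.L.sec j q)
        rw [sdiv_self, one_mul, one_mul, dstar_sdiv_dstar, ← mul_assoc, sdiv_mul_sdiv_cancel,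
          sdiv_self, one_mul] }
  compat x₁ x₂ y₁ y₂ h₁ h₂ hx l₁ l₂ k₁ k₂ e₁ e₂ := by
    obtain ⟨a₁, ha₁⟩ := exists_right (s.θ.val ⟨(x₁, y₁), h₁⟩) (dstar l₁)
    obtain ⟨c₁, hc₁⟩ := exists_right (t.θ.val ⟨(x₁, y₁), h₁⟩) (dstar a₁)
    obtain ⟨a₂, ha₂⟩ := exists_right (s.θ.val ⟨(x₂, y₂), h₂⟩) (dstar l₂)
    obtain ⟨c₂, hc₂⟩ := exists_right (t.θ.val ⟨(x₂, y₂), h₂⟩) (dstar a₂)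
    replace e₁ : contract (s.θ.val ⟨(x₁, y₁), h₁⟩) (t.θ.val ⟨(x₁, y₁), h₁⟩) = _ := e₁
    replace e₂ : contract (s.θ.val ⟨(x₂, y₂), h₂⟩) (t.θ.val ⟨(x₂, y₂), h₂⟩) = _ := e₂
    rw [ha₁, hc₁, contract_tmul] at e₁
    rw [ha₂, hc₂, contract_tmul] at e₂
    obtain rfl := tmul_left_cancel e₁
    obtain rfl := tmul_left_cancel e₂
    exact (s.compat _ _ _ _ _ _ hx _ _ _ _ ha₁ ha₂).trans
      (t.compat _ _ _ _ _ _ hx _ _ _ _ hc₁ hc₂)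

/-- The category `Hom_s(P, Q)` of stable morphisms and transformations. -/
instance : Category (StableMorphism G K) where
  Hom := Transformation
  id := Transformation.id
  comp := Transformation.comp
  id_comp {f g} s := by
    refine Transformation.ext (CBundle.Sect.ext (funext fun b => ?_))
    obtain ⟨l, k, h⟩ := exists_tmul (s.θ.val b)
    change contract (coev (f.L.Fib b)) (s.θ.val b) = s.θ.val b
    rw [h, coev_eq l.undstar]
    exact contract_tmul l l.undstar k
  comp_id {f g} s := by
    refine Transformation.ext (CBundle.Sect.ext (funext fun b => ?_))
    obtain ⟨l, k, h⟩ := exists_tmul (s.θ.val b)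
    change contract (s.θ.val b) (coev (g.L.Fib b)) = s.θ.val b
    rw [h, coev_eq k]
    exact contract_tmul l k k
  assoc {f g h k} s t r := by
    refine Transformation.ext (CBundle.Sect.ext (funext fun b => ?_))
    obtain ⟨l, a, ha⟩ := exists_tmul (s.θ.val b)
    obtain ⟨c, hc⟩ := exists_right (t.θ.val b) (dstar a)
    obtain ⟨d, hd⟩ := exists_right (r.θ.val b) (dstar c)
    change contract (contract (s.θ.val b) (t.θ.val b)) (r.θ.val b) =
      contract (s.θ.val b) (contract (t.θ.val b) (r.θ.val b))
    rw [ha, hc, hd, contract_tmul, contract_tmul, contract_tmul, contract_tmul]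

/-- The value of a transformation `f ⇒ g` in `L_f(x, y)* ⊗ L_g(x, y)`. -/
def value {f g : StableMorphism G K} (s : f ⟶ g) {x : G.X} {y : K.X} (h : G.π x = K.π y) :
    TensorTorsor (DualTorsor (f.fib h)) (g.fib h) :=
  Transformation.θ s |>.val ⟨(x, y), h⟩

end StableMorphism

/-! ## Composites of stable morphisms and identity stable morphisms -/

section Composition

variable {G K R : BundleGerbe E M}

/-- The `ℂˣ`-bundle on `X ×_M Z ×_M Y^[2]` with fibre `L_f(x, y₁) ⊗ L_g(y₂, z) ⊗ Q(y₁, y₂)` at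
`(x, z, y₁, y₂)`. -/
abbrev compBundle (f : StableMorphism G K) (g : StableMorphism K R) :
    CBundle (G.I.prod (R.I.prod (K.I.prod K.I))) (G.fpComp K.toLocallySplit R.toLocallySplit) :=
  ((f.L.pullback (G.fpComp K.toLocallySplit R.toLocallySplit) (fun p => (p.1, p.2.2.1))
      (contMDiff_fst.prodMk (contMDiff_fst.comp (contMDiff_snd.comp contMDiff_snd)))
      fun _ h => h.1).tensor
    (g.L.pullback (G.fpComp K.toLocallySplit R.toLocallySplit) (fun p => (p.2.2.2, p.2.1))
      ((contMDiff_snd.comp (contMDiff_snd.comp contMDiff_snd)).prodMk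
        (contMDiff_fst.comp contMDiff_snd))
      fun _ h => h.2.2)).tensor
    (K.P.pullback (G.fpComp K.toLocallySplit R.toLocallySplit) (fun p => (p.2.2.1, p.2.2.2))
      ((contMDiff_fst.comp (contMDiff_snd.comp contMDiff_snd)).prodMk
        (contMDiff_snd.comp (contMDiff_snd.comp contMDiff_snd)))
      fun _ h => h.2.1)

/-- The pullback to `X ×_M Z ×_M Y^[2]` of the bundle `L_k` on `X ×_M Z`. -/
abbrev compTarget (K : BundleGerbe E M) (k : StableMorphism G R) :
    CBundle (G.I.prod (R.I.prod (K.I.prod K.I))) (G.fpComp K.toLocallySplit R.toLocallySplit) :=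
  k.L.pullback (G.fpComp K.toLocallySplit R.toLocallySplit) (fun p => (p.1, p.2.1))
    (contMDiff_fst.prodMk (contMDiff_fst.comp contMDiff_snd))
    fun _ h => h.1.trans (h.2.1.trans h.2.2)

/-- The image in `L_k(x, z)` of the element `a ⊗ b ⊗ q` of
`L_f(x, y₁) ⊗ L_g(y₂, z) ⊗ Q(y₁, y₂)`. -/
def glue {f : StableMorphism G K} {g : StableMorphism K R} {k : StableMorphism G R}
    (κ : CBundle.Iso (compBundle f g) (compTarget K k)) {x : G.X} {y₁ y₂ : K.X} {z : R.X}
    {h₁ : G.π x = K.π y₁} {h₂ : K.π y₁ = K.π y₂} {h₃ : K.π y₂ = R.π z}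
    (a : f.fib h₁) (b : g.fib h₃) (q : K.fib h₂) : k.fib (h₁.trans (h₂.trans h₃)) :=
  κ.map ⟨(x, z, y₁, y₂), h₁, h₂, h₃⟩ (tmul (tmul a b) q)

/-- `Composite f g k` exhibits the stable morphism `k : P → R` as the composite `g ∘ f` of
`f : P → Q` and `g : Q → R`: an isomorphism `κ` from `L_f(x, y₁) ⊗ L_g(y₂, z) ⊗ Q(y₁, y₂)` to the
pullback of `L_k`, such that `φ_k` is the isomorphism induced on `δ(L_k)` by
`L_f(x', y₁') ⊗ L_g(y₂', z') ⊗ Q(y₁', y₂') ⊗ (L_f(x, y₁) ⊗ L_g(y₂, z) ⊗ Q(y₁, y₂))*`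
`≃ P(x, x')* ⊗ Q(y₁, y₁') ⊗ Q(y₂, y₂')* ⊗ R(z, z') ⊗ Q(y₁', y₂') ⊗ Q(y₁, y₂)*`
`≃ P(x, x')* ⊗ R(z, z')`,
where the first step is `φ_f ⊗ φ_g` and the second one is the bundle gerbe product of `Q`. The case
`x = x'`, `z = z'` says that `κ` is compatible with the descent isomorphism
`L_f(x, y₁) ⊗ L_g(y₂, z) ⊗ Q(y₁, y₂) → L_f(x, y₁') ⊗ L_g(y₂', z) ⊗ Q(y₁', y₂')`, so that `L_k` is
the descended bundle. -/
structure Composite (f : StableMorphism G K) (g : StableMorphism K R)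
    (k : StableMorphism G R) where
  κ : CBundle.Iso (compBundle f g) (compTarget K k)
  phi_glue : ∀ (x x' : G.X) (y₁ y₂ y₁' y₂' : K.X) (z z' : R.X)
    (h₁ : G.π x = K.π y₁) (h₂ : K.π y₁ = K.π y₂) (h₃ : K.π y₂ = R.π z)
    (h₁' : G.π x' = K.π y₁') (h₂' : K.π y₁' = K.π y₂') (h₃' : K.π y₂' = R.π z')
    (hx : G.π x = G.π x') (hy₁ : K.π y₁ = K.π y₁') (hy₂ : K.π y₂ = K.π y₂') (hz : R.π z = R.π z')
    (a : f.fib h₁) (b : g.fib h₃) (q : K.fib h₂)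
    (a' : f.fib h₁') (b' : g.fib h₃') (q' : K.fib h₂')
    (p : G.fib hx) (s : K.fib hy₁) (t : K.fib hy₂) (r : R.fib hz),
    f.phi hx a' a = tmul (dstar p) s → g.phi hy₂ b' b = tmul (dstar t) r →
    K.mul q' s = K.mul t q →
    k.phi hx (glue κ a' b' q') (glue κ a b q) = tmul (dstar p) r

/-- `IdentityOn G k` exhibits the stable morphism `k : P → P` as the one induced by the identity of
`P`, whose bundle on `X ×_M X = X^[2]` is `P` itself with the isomorphism
`P(x₂, y₂) ⊗ P(x₁, y₁)* ≃ P(x₁, x₂)* ⊗ P(y₁, y₂)` given by the bundle gerbe product. -/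
structure IdentityOn (G : BundleGerbe E M) (k : StableMorphism G G) where
  ι : CBundle.Iso G.P k.L
  phi_ι : ∀ (x₁ x₂ y₁ y₂ : G.X) (h₁ : G.π x₁ = G.π y₁) (h₂ : G.π x₂ = G.π y₂)
    (hx : G.π x₁ = G.π x₂) (hy : G.π y₁ = G.π y₂)
    (u₁ : G.fib h₁) (u₂ : G.fib h₂) (p : G.fib hx) (q : G.fib hy),
    G.mul u₂ p = G.mul q u₁ →
    k.phi hx (ι.map ⟨(x₂, y₂), h₂⟩ u₂) (ι.map ⟨(x₁, y₁), h₁⟩ u₁) = tmul (dstar p) q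

end Composition

end Gerbes

/-! ## The bicategory structure on bundle gerbes and stable morphisms -/

section StableBicategory

variable {E M : Type u} [NormedAddCommGroup E] [NormedSpace ℝ E] [TopologicalSpace M]
  [ChartedSpace E M]

/-- The operations of a bicategory on bundle gerbes, stable morphisms and transformations are the
ones of the theory of bundle gerbes: composites and identities of stable morphisms are as in
`Composite` and `IdentityOn`, and under the isomorphisms given there the horizontal compositions
and the structural 2-arrows are the evident ones. -/
structure StableOperations (𝔅 : BicategoryOn (StableMorphism (E := E) (M := M))) where
  composite {G K R : BundleGerbe E M} (f : StableMorphism G K) (g : StableMorphism K R) :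
    Composite f g (𝔅.comp f g)
  identity (G : BundleGerbe E M) : IdentityOn G (𝔅.id G)
  /-- `a ⊗ b ⊗ q ↦ a ⊗ ρ(b) ⊗ q` -/
  whiskerLeft_value {G K R : BundleGerbe E M} (f : StableMorphism G K) (g g' : StableMorphism K R)
    (ρ : g ⟶ g') (x : G.X) (y₁ y₂ : K.X) (z : R.X)
    (h₁ : G.π x = K.π y₁) (h₂ : K.π y₁ = K.π y₂) (h₃ : K.π y₂ = R.π z)
    (a : f.fib h₁) (b : g.fib h₃) (b' : g'.fib h₃) (q : K.fib h₂) :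
    StableMorphism.value ρ h₃ = tmul (dstar b) b' →
    StableMorphism.value (𝔅.whiskerLeft f ρ) (h₁.trans (h₂.trans h₃)) =
      tmul (dstar (glue (composite f g).κ a b q)) (glue (composite f g').κ a b' q)
  /-- `a ⊗ b ⊗ q ↦ θ(a) ⊗ b ⊗ q` -/
  whiskerRight_value {G K R : BundleGerbe E M} (f f' : StableMorphism G K) (g : StableMorphism K R)
    (θ : f ⟶ f') (x : G.X) (y₁ y₂ : K.X) (z : R.X)
    (h₁ : G.π x = K.π y₁) (h₂ : K.π y₁ = K.π y₂) (h₃ : K.π y₂ = R.π z)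
    (a : f.fib h₁) (a' : f'.fib h₁) (b : g.fib h₃) (q : K.fib h₂) :
    StableMorphism.value θ h₁ = tmul (dstar a) a' →
    StableMorphism.value (𝔅.whiskerRight θ g) (h₁.trans (h₂.trans h₃)) =
      tmul (dstar (glue (composite f g).κ a b q)) (glue (composite f' g).κ a' b q)
  /-- `(a ⊗ b ⊗ q) ⊗ c ⊗ r ↦ a ⊗ (b ⊗ c ⊗ r) ⊗ q` -/
  associator_value {G K R T : BundleGerbe E M} (f : StableMorphism G K) (g : StableMorphism K R)
    (h : StableMorphism R T) (x : G.X) (y₁ y₂ : K.X) (z₁ z₂ : R.X) (t : T.X)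
    (h₁ : G.π x = K.π y₁) (h₂ : K.π y₁ = K.π y₂) (h₃ : K.π y₂ = R.π z₁) (h₄ : R.π z₁ = R.π z₂)
    (h₅ : R.π z₂ = T.π t)
    (a : f.fib h₁) (b : g.fib h₃) (c : h.fib h₅) (q : K.fib h₂) (r : R.fib h₄) :
    StableMorphism.value (𝔅.associator f g h).hom
        (h₁.trans (h₂.trans (h₃.trans (h₄.trans h₅)))) =
      tmul (dstar (glue (composite (𝔅.comp f g) h).κ (glue (composite f g).κ a b q) c r))
        (glue (composite f (𝔅.comp g h)).κ a (glue (composite g h).κ b c r) q)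
  /-- `u ⊗ b ⊗ q ↦ a`, where `a ∈ L_f(x, y)` is the image of `b ∈ L_f(x₂, y)` and of
  `q u ∈ P(x, x₂)` under `L_f(x₂, y) ⊗ P(x, x₂) ≃ Q(y, y) ⊗ L_f(x, y) ≃ L_f(x, y)` -/
  leftUnitor_value {G K : BundleGerbe E M} (f : StableMorphism G K) (x x₁ x₂ : G.X) (y : K.X)
    (h₁ : G.π x = G.π x₁) (h₂ : G.π x₁ = G.π x₂) (h₃ : G.π x₂ = K.π y)
    (u : G.fib h₁) (b : f.fib h₃) (q : G.fib h₂) (a : f.fib (h₁.trans (h₂.trans h₃)))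
    (e : K.fib (rfl : K.π y = K.π y)) :
    K.mul e e = e → f.phi (h₁.trans h₂) b a = tmul (dstar (G.mul q u)) e →
    StableMorphism.value (𝔅.leftUnitor f).hom (h₁.trans (h₂.trans h₃)) =
      tmul (dstar (glue (composite (𝔅.id G) f).κ ((identity G).ι.map ⟨(x, x₁), h₁⟩ u) b q)) a
  /-- `a ⊗ v ⊗ q ↦ a'`, where `a' ∈ L_f(x, y)` is the image of `a ∈ L_f(x, y₁)` and of
  `v q ∈ Q(y₁, y)` under `Q(y₁, y) ⊗ L_f(x, y₁) ≃ L_f(x, y) ⊗ P(x, x) ≃ L_f(x, y)` -/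
  rightUnitor_value {G K : BundleGerbe E M} (f : StableMorphism G K) (x : G.X) (y₁ y₂ y : K.X)
    (h₁ : G.π x = K.π y₁) (h₂ : K.π y₁ = K.π y₂) (h₃ : K.π y₂ = K.π y)
    (a : f.fib h₁) (v : K.fib h₃) (q : K.fib h₂) (a' : f.fib (h₁.trans (h₂.trans h₃)))
    (e : G.fib (rfl : G.π x = G.π x)) :
    G.mul e e = e → f.phi rfl a' a = tmul (dstar e) (K.mul v q) →
    StableMorphism.value (𝔅.rightUnitor f).hom (h₁.trans (h₂.trans h₃)) =
      tmul (dstar (glue (composite f (𝔅.id K)).κ a ((identity K).ι.map ⟨(y₂, y), h₃⟩ v) q)) a'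

end StableBicategory

/-!
The isomorphism `φ` of a stable morphism `L : P → Q` is the same as a pair of commuting smooth
actions on `L`, of the groupoid `Q` from the left and of the groupoid `P` from the right:
`φ(l₂ ⊗ l₁*) = p* ⊗ q` means `l₂ p = q l₁`. In these terms stable morphisms are principal bimodules,
and transformations are bundle maps that commute with the actions; such maps are bijective on
fibres because the fibres are torsors.

The composite of `L_f` and `L_g` is the balanced tensor product over `Q`, in which `a q ⊗ c` and
`a ⊗ q c` are identified. Its fibre can be realised at any one point of the fibre of `Y → M`, and
moving that point along a smooth local section of `Y → M` shows that it is a smooth bundle. A map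
out of it is a balanced map, so the structural 2-arrows are written down, and the coherence laws
checked, on elements `a ⊗ c`. The inverse of `L` is `L*` with the actions through the inverses of
the groupoids, and it is contracted with `L` by the division `(a, a') ↦ p` with `a = a' p`.
-/

theorem bijective_of_map_smul {Γ A B : Type*} [Group Γ] [Torsor Γ A] [Torsor Γ B] {Φ : A → B}
    (hΦ : ∀ (c : Γ) a, Φ (c • a) = c • Φ a) : Function.Bijective Φ := by
  refine ⟨fun a a' h => ?_, fun t => ?_⟩
  · have h' : (a /ₛ a') • Φ a' = (1 : Γ) • Φ a' := by rw [← hΦ, sdiv_smul, h, one_smul]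
    rw [← sdiv_smul a a', smul_right_cancel _ h', one_smul]
  · let a : A := Classical.arbitrary A
    exact ⟨(t /ₛ Φ a) • a, by rw [hΦ, sdiv_smul]⟩

namespace TensorTorsor

variable {A B : Type u} [Torsor ℂˣ A] [Torsor ℂˣ B] {C : Type v}

/-- The map out of `A ⊗ B` given by a balanced map on `A × B`. -/
def lift (F : A → B → C) (hF : ∀ (c : ℂˣ) a b, F (c • a) b = F a (c • b)) :
    TensorTorsor A B → C :=
  Quotient.lift (s := tensorSetoid A B) (fun p => F p.1 p.2) (by
    rintro ⟨a, b⟩ ⟨a', b'⟩ ⟨c, h1, h2⟩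
    simp only at h1 h2 ⊢
    rw [h1, h2, hF, smul_inv_smul])

theorem lift_tmul (F : A → B → C) (hF : ∀ (c : ℂˣ) a b, F (c • a) b = F a (c • b))
    (a : A) (b : B) : lift F hF (tmul a b) = F a b := rfl

theorem smul_tmul_right (c : ℂˣ) (a : A) (b : B) : c • tmul a b = tmul a (c • b) := by
  rw [smul_tmul, smul_tmul_eq]

end TensorTorsor

/-! ## Sections along smooth maps -/

noncomputable section SmoothSections

variable {E H N E' H' N' E'' H'' N'' : Type u}
  [NormedAddCommGroup E] [NormedSpace ℝ E] [TopologicalSpace H]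
  {I : ModelWithCorners ℝ E H} [TopologicalSpace N] [ChartedSpace H N]
  [NormedAddCommGroup E'] [NormedSpace ℝ E'] [TopologicalSpace H']
  {J : ModelWithCorners ℝ E' H'} [TopologicalSpace N'] [ChartedSpace H' N']
  [NormedAddCommGroup E''] [NormedSpace ℝ E''] [TopologicalSpace H'']
  {I' : ModelWithCorners ℝ E'' H''} [TopologicalSpace N''] [ChartedSpace H'' N'']
  {T : Set N'} {p : T}

/-- A map from a subset `T` of a manifold to a manifold is smooth at `p` if near `p` it is the
restriction of a smooth map of the ambient manifold. -/
def SmoothMapAt (J : ModelWithCorners ℝ E' H') (I : ModelWithCorners ℝ E H) (k : T → N) (p : T) :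
    Prop :=
  ∃ K : N' → N, (∀ᶠ q in 𝓝 (p : N'), ContMDiffAt J I ∞ K q) ∧ ∀ᶠ q in 𝓝 p, k q = K q

theorem SmoothMapAt.val : SmoothMapAt J J (fun q : T => (q : N')) p :=
  ⟨id, .of_forall fun _ => contMDiffAt_id, .of_forall fun _ => rfl⟩

theorem SmoothMapAt.continuousAt {k : T → N} (hk : SmoothMapAt J I k p) : ContinuousAt k p := by
  obtain ⟨K, hK, e⟩ := hk
  exact (hK.self_of_nhds.continuousAt.comp (f := ((↑) : T → N'))
    continuousAt_subtype_val).congr (e.mono fun _ h => h.symm)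

theorem SmoothMapAt.comp {k : T → N} {F : N → N''}
    (hF : ∀ᶠ q in 𝓝 (k p), ContMDiffAt I I' ∞ F q) (hk : SmoothMapAt J I k p) :
    SmoothMapAt J I' (fun q => F (k q)) p := by
  obtain ⟨K, hK, e⟩ := hk
  refine ⟨fun q => F (K q), ?_, e.mono fun q h => congrArg F h⟩
  rw [e.self_of_nhds] at hF
  filter_upwards [hK, hK.self_of_nhds.continuousAt.eventually hF] with q h1 h2
  exact h2.comp q h1

theorem SmoothMapAt.comp_contMDiff {k : T → N} {F : N → N''} (hF : ContMDiff I I' ∞ F)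
    (hk : SmoothMapAt J I k p) : SmoothMapAt J I' (fun q => F (k q)) p :=
  hk.comp (.of_forall fun _ => hF.contMDiffAt)

theorem SmoothMapAt.prodMk {k : T → N} {k' : T → N''} (hk : SmoothMapAt J I k p)
    (hk' : SmoothMapAt J I' k' p) : SmoothMapAt J (I.prod I') (fun q => (k q, k' q)) p := by
  obtain ⟨K, hK, e⟩ := hk
  obtain ⟨K', hK', e'⟩ := hk'
  refine ⟨fun q => (K q, K' q), ?_, ?_⟩
  · filter_upwards [hK, hK'] with q h1 h2 using h1.prodMk h2
  · filter_upwards [e, e'] with q h1 h2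
    rw [h1, h2]

theorem SmoothMapAt.fst {k : T → N × N''} (hk : SmoothMapAt J (I.prod I') k p) :
    SmoothMapAt J I (fun q => (k q).1) p :=
  hk.comp_contMDiff contMDiff_fst

theorem SmoothMapAt.snd {k : T → N × N''} (hk : SmoothMapAt J (I.prod I') k p) :
    SmoothMapAt J I' (fun q => (k q).2) p :=
  hk.comp_contMDiff contMDiff_snd

theorem SmoothAtOn.comp {S : Set N} {k : T → S} {f : S → ℂˣ} (hf : SmoothAtOn I S f (k p))
    (hk : SmoothMapAt J I (fun q => (k q : N)) p) : SmoothAtOn J T (fun q => f (k q)) p := by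
  have hc : ContinuousAt k p := Topology.IsInducing.subtypeVal.continuousAt_iff.2 hk.continuousAt
  obtain ⟨g, hg, hfg⟩ := hf
  obtain ⟨K, hK, e⟩ := hk
  refine ⟨fun q => g (K q), ?_, ?_⟩
  · replace hg : ∀ᶠ q in 𝓝 (K p), ContMDiffAt I 𝓘(ℝ, ℂ) ∞ g q := e.self_of_nhds ▸ hg
    filter_upwards [hK, hK.self_of_nhds.continuousAt.eventually hg] with q h1 h2
    exact h2.comp q h1
  · filter_upwards [e, hc.eventually hfg] with q h1 h2
    rw [h2, ← h1]

theorem SmoothAtOn.inv {f : T → ℂˣ} (hf : SmoothAtOn J T f p) :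
    SmoothAtOn J T (fun q => (f q)⁻¹) p := by
  obtain ⟨g, hg, hfg⟩ := hf
  have h0 : g p ≠ 0 := hfg.self_of_nhds ▸ (f p).ne_zero
  refine ⟨fun q => (g q)⁻¹, ?_, hfg.mono fun q h => by rw [Units.val_inv_eq_inv_val, h]⟩
  filter_upwards [hg, hg.self_of_nhds.continuousAt.eventually_ne h0] with q h1 h2
  exact (contDiffAt_inv ℝ h2).contMDiffAt.comp q h1

theorem SmoothAtOn.div {f f' : T → ℂˣ} (hf : SmoothAtOn J T f p) (hf' : SmoothAtOn J T f' p) :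
    SmoothAtOn J T (fun q => f q / f' q) p :=
  (hf.mul hf'.inv).congr fun _ => (div_eq_mul_inv _ _).symm

/-- The map `k` and the section `s` of `L` along it are smooth at `p`. -/
structure SmoothAlong {S : Set N} (J : ModelWithCorners ℝ E' H') (L : CBundle I S) (k : T → S)
    (s : ∀ q, L.Fib (k q)) (p : T) : Prop where
  base : SmoothMapAt J I (fun q => (k q : N)) p
  sdiv_sec : ∀ i, k p ∈ L.U i → SmoothAtOn J T (fun q => s q /ₛ L.sec i (k q)) p

namespace SmoothAlong

variable {S : Set N} {L : CBundle I S} {k : T → S} {s t : ∀ q, L.Fib (k q)}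

theorem sec (hk : SmoothMapAt J I (fun q => (k q : N)) p) {i : L.Idx} (hi : k p ∈ L.U i) :
    SmoothAlong J L k (fun q => L.sec i (k q)) p :=
  ⟨hk, fun j hj => (L.smooth_transition i j (k p) hi hj).comp hk⟩

theorem _root_.CBundle.exists_smoothAlong (L : CBundle I S) {k : T → S}
    (hk : SmoothMapAt J I (fun q => (k q : N)) p) : ∃ s, SmoothAlong J L k s p :=
  let ⟨_, hi⟩ := L.cover (k p)
  ⟨_, sec hk hi⟩

theorem sdiv (hs : SmoothAlong J L k s p) (ht : SmoothAlong J L k t p) :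
    SmoothAtOn J T (fun q => s q /ₛ t q) p := by
  obtain ⟨i, hi⟩ := L.cover (k p)
  exact ((hs.sdiv_sec i hi).div (ht.sdiv_sec i hi)).congr fun _ => sdiv_div_sdiv_cancel_right _ _ _

theorem of_sdiv (ht : SmoothAlong J L k t p) (h : SmoothAtOn J T (fun q => s q /ₛ t q) p) :
    SmoothAlong J L k s p :=
  ⟨ht.base, fun i hi => (h.mul (ht.sdiv_sec i hi)).congr fun _ => sdiv_mul_sdiv_cancel _ _ _⟩

theorem congr (hs : SmoothAlong J L k s p) (e : ∀ q, s q = t q) : SmoothAlong J L k t p :=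
  (funext e : s = t) ▸ hs

variable {S' : Set N''} {L' : CBundle I' S'} {k' : T → S'}

theorem of_map {Φ : ∀ q, L.Fib (k q) → L'.Fib (k' q)}
    (hΦ : ∀ q (c : ℂˣ) l, Φ q (c • l) = c • Φ q l)
    (hΦs : ∀ t, SmoothAlong J L k t p → SmoothAlong J L' k' (fun q => Φ q (t q)) p)
    (hk : SmoothMapAt J I (fun q => (k q : N)) p)
    (hs : SmoothAlong J L' k' (fun q => Φ q (s q)) p) : SmoothAlong J L k s p := by
  obtain ⟨t, ht⟩ := L.exists_smoothAlong hk
  refine of_sdiv ht ((hs.sdiv (hΦs t ht)).congr fun q => ?_)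
  conv_lhs => rw [← sdiv_smul (s q) (t q), hΦ, smul_sdiv]

theorem map {Φ : ∀ q, L.Fib (k q) → L'.Fib (k' q)}
    (hΦ : ∀ q (c : ℂˣ) l, Φ q (c • l) = c • Φ q l)
    (ht : SmoothAlong J L k t p) (ht' : SmoothAlong J L' k' (fun q => Φ q (t q)) p)
    (hs : SmoothAlong J L k s p) : SmoothAlong J L' k' (fun q => Φ q (s q)) p := by
  refine of_sdiv ht' ((hs.sdiv ht).congr fun q => ?_)
  conv_rhs => rw [← sdiv_smul (s q) (t q), hΦ, smul_sdiv]

theorem dstar (hs : SmoothAlong J L k s p) :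
    SmoothAlong J L.dual k (fun q => DualTorsor.dstar (s q)) p := by
  refine ⟨hs.base, fun i hi => (hs.sdiv_sec i hi).inv.congr fun q => ?_⟩
  rw [inv_sdiv_eq_sdiv_rev]; rfl

theorem of_dstar (hs : SmoothAlong J L.dual k (fun q => DualTorsor.dstar (s q)) p) :
    SmoothAlong J L k s p := by
  refine ⟨hs.base, fun i hi => (hs.sdiv_sec i hi).inv.congr fun q => ?_⟩
  rw [inv_sdiv_eq_sdiv_rev]; rfl

theorem tmul {L' : CBundle I S} {s' : ∀ q, L'.Fib (k q)} (hs : SmoothAlong J L k s p)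
    (hs' : SmoothAlong J L' k s' p) :
    SmoothAlong J (L.tensor L') k (fun q => TensorTorsor.tmul (s q) (s' q)) p :=
  ⟨hs.base, fun i hi => (hs.sdiv_sec i.1 hi.1).mul (hs'.sdiv_sec i.2 hi.2)⟩

theorem of_tmul_left {L' : CBundle I S} {s' : ∀ q, L'.Fib (k q)} (hs : SmoothAlong J L k s p)
    (h : SmoothAlong J (L.tensor L') k (fun q => TensorTorsor.tmul (s q) (s' q)) p) :
    SmoothAlong J L' k s' p :=
  of_map (L := L') (L' := L.tensor L')
    (Φ := fun q l => TensorTorsor.tmul (s q) l)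
    (fun _ _ _ => (smul_tmul_right _ _ _).symm) (fun _ ht => hs.tmul ht) hs.base h

theorem iso_map {L' : CBundle I S} (F : CBundle.Iso L L') (hs : SmoothAlong J L k s p) :
    SmoothAlong J L' k (fun q => F.map (k q) (s q)) p := by
  obtain ⟨i, hi⟩ := L.cover (k p)
  refine SmoothAlong.map (t := fun q => L.sec i (k q)) (fun q => F.map_smul _) (sec hs.base hi)
    ⟨hs.base, fun j hj => ?_⟩ hs
  exact (F.smooth i j (k p) hi hj).comp hs.base

theorem pullback {S' : Set N''} {k : T → S'} {K : N'' → N} {hK : ContMDiff I' I ∞ K}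
    {hS : ∀ q ∈ S', K q ∈ S} {s : ∀ q, L.Fib ⟨K (k q), hS _ (k q).2⟩}
    (hk : SmoothMapAt J I' (fun q => (k q : N'')) p)
    (hs : SmoothAlong J L (fun q => ⟨K (k q), hS _ (k q).2⟩) s p) :
    SmoothAlong J (L.pullback S' K hK hS) k s p :=
  ⟨hk, hs.sdiv_sec⟩

theorem of_pullback {S' : Set N''} {k : T → S'} {K : N'' → N} {hK : ContMDiff I' I ∞ K}
    {hS : ∀ q ∈ S', K q ∈ S} {s : ∀ q, L.Fib ⟨K (k q), hS _ (k q).2⟩}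
    (hs : SmoothAlong J (L.pullback S' K hK hS) k s p) :
    SmoothAlong J L (fun q => ⟨K (k q), hS _ (k q).2⟩) s p :=
  ⟨SmoothMapAt.comp_contMDiff (F := K) hK hs.base, hs.sdiv_sec⟩

end SmoothAlong

namespace CBundle

variable {S : Set N} {L L' : CBundle I S}

/-- A fibrewise equivariant map is an isomorphism of bundles if near each point it sends some
smooth section to a smooth section. -/
def Iso.ofExists (m : ∀ b, L.Fib b → L'.Fib b) (hm : ∀ b (c : ℂˣ) l, m b (c • l) = c • m b l)
    (h : ∀ b, ∃ s, SmoothAlong I L (fun q : S => q) s b ∧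
      SmoothAlong I L' (fun q : S => q) (fun q => m q (s q)) b) : Iso L L' where
  map := m
  map_smul := hm
  smooth i j b hi hj := by
    obtain ⟨s, hs, hs'⟩ := h b
    exact (SmoothAlong.map (Φ := fun q l => m q l) hm hs hs'
      (SmoothAlong.sec .val hi)).sdiv_sec j hj

/-- The section of `L* ⊗ L'` that corresponds to an isomorphism `L → L'`. -/
def Iso.toSect (F : Iso L L') : (L.dual.tensor L').Sect where
  val b := tmul (dstar (Classical.arbitrary (L.Fib b))) (F.map b (Classical.arbitrary (L.Fib b)))
  smooth := by
    rintro ⟨i, j⟩ b ⟨hi, hj⟩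
    refine (F.smooth i j b hi hj).congr fun q => ?_
    generalize Classical.arbitrary (L.Fib q) = l
    rw [tmul_sdiv_tmul, dstar_sdiv_dstar, ← sdiv_smul l (L.sec i q), F.map_smul, smul_sdiv_assoc,
      sdiv_smul_eq_sdiv_div, sdiv_self, ← mul_assoc, one_div, inv_mul_cancel, one_mul]

theorem Iso.toSect_val (F : Iso L L') (b : S) (l : L.Fib b) :
    F.toSect.val b = tmul (dstar l) (F.map b l) := by
  change tmul (dstar (Classical.arbitrary (L.Fib b)))
    (F.map b (Classical.arbitrary (L.Fib b))) = _
  generalize Classical.arbitrary (L.Fib b) = l'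
  rw [← sdiv_smul l' l, F.map_smul, ← smul_tmul_eq, smul_dstar, inv_smul_smul]

end CBundle

end SmoothSections

noncomputable section

variable {E M : Type u} [NormedAddCommGroup E] [NormedSpace ℝ E] [TopologicalSpace M]
  [ChartedSpace E M]
variable {E' H' N' : Type u} [NormedAddCommGroup E'] [NormedSpace ℝ E'] [TopologicalSpace H']
  {J : ModelWithCorners ℝ E' H'} [TopologicalSpace N'] [ChartedSpace H' N'] {T : Set N'} {b : T}

/-! ## The groupoid of a bundle gerbe -/

namespace BundleGerbe

variable (G : BundleGerbe E M)

section Algebra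

variable {x₁ x₂ x₃ x₄ : G.X} {h₁₂ : G.π x₁ = G.π x₂} {h₂₃ : G.π x₂ = G.π x₃}
  {h₃₄ : G.π x₃ = G.π x₄}

theorem smul_mul (c : ℂˣ) (s : G.fib h₂₃) (t : G.fib h₁₂) :
    G.mul (c • s) t = c • G.mul s t :=
  G.product.map_smul ⟨(x₁, x₂, x₃), h₁₂, h₂₃⟩ c (tmul s t)

theorem mul_smul (c : ℂˣ) (s : G.fib h₂₃) (t : G.fib h₁₂) :
    G.mul s (c • t) = c • G.mul s t := by
  rw [← smul_mul, mul, mul, smul_tmul_eq]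

theorem mul_assoc (s : G.fib h₃₄) (t : G.fib h₂₃) (r : G.fib h₁₂) :
    G.mul (G.mul s t) r = G.mul s (G.mul t r) :=
  G.product_assoc _ _ _ _ _ _ _ s t r

theorem exists_one (x : G.X) : ∃ e : G.fib (rfl : G.π x = G.π x), G.mul e e = e := by
  let u : G.fib (rfl : G.π x = G.π x) := Classical.arbitrary _
  refine ⟨(u /ₛ G.mul u u) • u, ?_⟩
  rw [smul_mul, mul_smul, sdiv_smul]

/-- The unit of `P_(x, x)`. -/
def one (x : G.X) : G.fib (rfl : G.π x = G.π x) := Classical.choose (G.exists_one x)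

theorem one_mul_one (x : G.X) : G.mul (G.one x) (G.one x) = G.one x :=
  Classical.choose_spec (G.exists_one x)

theorem mul_right_injective (s : G.fib h₂₃) :
    Function.Injective fun t : G.fib h₁₂ => G.mul s t :=
  (bijective_of_map_smul fun c t => G.mul_smul c s t).1

theorem mul_left_bijective (t : G.fib h₁₂) :
    Function.Bijective fun s : G.fib h₂₃ => G.mul s t :=
  bijective_of_map_smul fun c s => G.smul_mul c s t

theorem one_mul (t : G.fib h₁₂) : G.mul (G.one x₂) t = t :=
  G.mul_right_injective (G.one x₂) ((G.mul_assoc _ _ t).symm.trans (by rw [one_mul_one]))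

theorem mul_one (t : G.fib h₁₂) : G.mul t (G.one x₁) = t :=
  (G.mul_left_bijective (G.one x₁)).1 ((G.mul_assoc t _ _).trans (by rw [one_mul_one]))

theorem eq_one {x : G.X} {e : G.fib (rfl : G.π x = G.π x)} (h : G.mul e e = e) :
    e = G.one x :=
  G.mul_right_injective e (h.trans (G.mul_one e).symm)

/-- The inverse `P_(x₁, x₂) → P_(x₂, x₁)` of the groupoid. -/
def inv (t : G.fib h₁₂) : G.fib h₁₂.symm :=
  Function.surjInv (G.mul_left_bijective t).2 (G.one x₁)

theorem inv_mul (t : G.fib h₁₂) : G.mul (G.inv t) t = G.one x₁ :=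
  Function.surjInv_eq (G.mul_left_bijective t).2 _

theorem mul_inv (t : G.fib h₁₂) : G.mul t (G.inv t) = G.one x₂ := by
  refine G.eq_one ?_
  rw [mul_assoc, ← G.mul_assoc (G.inv t) t, inv_mul, one_mul]

theorem inv_mul_cancel_left (t : G.fib h₁₂) {x₀ : G.X} {h₀ : G.π x₀ = G.π x₁} (r : G.fib h₀) :
    G.mul (G.inv t) (G.mul t r) = r := by
  rw [← mul_assoc, inv_mul, one_mul]

theorem eq_inv {t : G.fib h₁₂} {s : G.fib h₁₂.symm} (h : G.mul s t = G.one x₁) :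
    s = G.inv t :=
  (G.mul_left_bijective t).1 (h.trans (G.inv_mul t).symm)

theorem inv_smul (c : ℂˣ) (t : G.fib h₁₂) : G.inv (c • t) = c⁻¹ • G.inv t :=
  (G.eq_inv (by rw [smul_mul, mul_smul, inv_mul, inv_smul_smul])).symm

theorem inv_one (x : G.X) : G.inv (G.one x) = G.one x :=
  (G.eq_inv (G.one_mul _)).symm

theorem inv_mul_rev (s : G.fib h₂₃) (t : G.fib h₁₂) :
    G.inv (G.mul s t) = G.mul (G.inv t) (G.inv s) :=
  (G.eq_inv (by rw [mul_assoc, inv_mul_cancel_left, inv_mul])).symm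

end Algebra

variable (J) in
/-- Smoothness at `b` of a section `s` of `P` along a map `(x₁, x₂) : T → X^[2]`. -/
abbrev Smooth {x₁ x₂ : T → G.X} {h : ∀ q, G.π (x₁ q) = G.π (x₂ q)} (s : ∀ q, G.fib (h q))
    (b : T) : Prop :=
  SmoothAlong J G.P (fun q => ⟨(x₁ q, x₂ q), h q⟩) s b

variable {G}

section

variable {x₁ x₂ x₃ : T → G.X} {h₁₂ : ∀ q, G.π (x₁ q) = G.π (x₂ q)}
  {h₂₃ : ∀ q, G.π (x₂ q) = G.π (x₃ q)}

variable (G) in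
theorem exists_smooth (hx₁ : SmoothMapAt J G.I x₁ b) (hx₂ : SmoothMapAt J G.I x₂ b)
    (h₁₂ : ∀ q, G.π (x₁ q) = G.π (x₂ q)) : ∃ s : ∀ q, G.fib (h₁₂ q), G.Smooth J s b :=
  G.P.exists_smoothAlong (k := fun q => ⟨(x₁ q, x₂ q), h₁₂ q⟩) (hx₁.prodMk hx₂)

theorem Smooth.mul {s : ∀ q, G.fib (h₂₃ q)} {t : ∀ q, G.fib (h₁₂ q)} (hs : G.Smooth J s b)
    (ht : G.Smooth J t b) : G.Smooth J (fun q => G.mul (s q) (t q)) b := by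
  have hk : SmoothMapAt J (G.I.prod (G.I.prod G.I)) (fun q => (x₁ q, x₂ q, x₃ q)) b :=
    ht.base.fst.prodMk hs.base
  exact (SmoothAlong.iso_map G.product
    (k := fun q => (⟨(x₁ q, x₂ q, x₃ q), h₁₂ q, h₂₃ q⟩ : G.fp3))
    (SmoothAlong.tmul (SmoothAlong.pullback hk hs) (SmoothAlong.pullback hk ht))).of_pullback

theorem smooth_one (hx₁ : SmoothMapAt J G.I x₁ b) :
    G.Smooth J (fun q => G.one (x₁ q)) b := by
  obtain ⟨u, hu⟩ := G.exists_smooth hx₁ hx₁ fun _ => rfl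
  refine SmoothAlong.of_map (L' := G.P) (Φ := fun q l => G.mul l (u q))
    (fun q c l => G.smul_mul c l (u q)) (fun t ht => Smooth.mul ht hu) hu.base ?_
  exact hu.congr fun q => (G.one_mul _).symm

theorem Smooth.inv {t : ∀ q, G.fib (h₁₂ q)} (ht : G.Smooth J t b) :
    G.Smooth J (fun q => G.inv (t q)) b := by
  refine SmoothAlong.of_map (L' := G.P) (Φ := fun q l => G.mul l (t q))
    (fun q c l => G.smul_mul c l (t q)) (fun s hs => Smooth.mul hs ht)
    (ht.base.snd.prodMk ht.base.fst) ?_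
  exact (smooth_one ht.base.fst).congr fun q => (G.inv_mul _).symm

end

end BundleGerbe

namespace LocallySplit

theorem exists_section (A : LocallySplit E M) (m : M) : ∃ σ : M → A.X, (∀ m', A.π (σ m') = m') ∧
    ∀ᶠ m' in 𝓝 m, ContMDiffAt 𝓘(ℝ, E) A.I ∞ σ m' := by
  classical
  obtain ⟨U, σ, hU, hm, hσ, e⟩ := A.exists_localSection m
  refine ⟨fun m' => if m' ∈ U then σ m' else Function.surjInv A.surjective_π m', fun m' => ?_, ?_⟩
  · change A.π (if m' ∈ U then σ m' else Function.surjInv A.surjective_π m') = m'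
    split_ifs with h
    · exact e m' h
    · exact Function.surjInv_eq _ _
  · filter_upwards [hU.mem_nhds hm] with m' hm'
    refine (hσ.contMDiffAt (hU.mem_nhds hm')).congr_of_eventuallyEq ?_
    filter_upwards [hU.mem_nhds hm'] with m'' h
    exact if_pos h

end LocallySplit

/-! ## The actions on the bundle of a stable morphism -/

namespace StableMorphism

variable {G K : BundleGerbe E M} (f : StableMorphism G K)

section Algebra

variable {x x₁ x₂ x₃ : G.X} {y y₁ y₂ y₃ : K.X}

theorem phi_smul_left {h₁ : G.π x₁ = K.π y₁} {h₂ : G.π x₂ = K.π y₂} (hx : G.π x₁ = G.π x₂)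
    (c : ℂˣ) (l₂ : f.fib h₂) (l₁ : f.fib h₁) : f.phi hx (c • l₂) l₁ = c • f.phi hx l₂ l₁ :=
  f.φ.map_smul ⟨((x₁, y₁), (x₂, y₂)), h₁, h₂, hx⟩ c (tmul l₂ (dstar l₁))

theorem phi_smul_right {h₁ : G.π x₁ = K.π y₁} {h₂ : G.π x₂ = K.π y₂} (hx : G.π x₁ = G.π x₂)
    (c : ℂˣ) (l₂ : f.fib h₂) (l₁ : f.fib h₁) : f.phi hx l₂ (c • l₁) = c⁻¹ • f.phi hx l₂ l₁ := by
  rw [← phi_smul_left, phi, phi, smul_tmul_eq, smul_dstar, _root_.inv_inv]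

theorem phi_mul {h₁ : G.π x₁ = K.π y₁} {h₂ : G.π x₂ = K.π y₂} {h₃ : G.π x₃ = K.π y₃}
    {hx₁₂ : G.π x₁ = G.π x₂} {hx₂₃ : G.π x₂ = G.π x₃} {hy₁₂ : K.π y₁ = K.π y₂}
    {hy₂₃ : K.π y₂ = K.π y₃} {l₁ : f.fib h₁} {l₂ : f.fib h₂} {l₃ : f.fib h₃} {p : G.fib hx₂₃}
    {p' : G.fib hx₁₂} {q : K.fib hy₂₃} {q' : K.fib hy₁₂}
    (e : f.phi hx₂₃ l₃ l₂ = tmul (dstar p) q) (e' : f.phi hx₁₂ l₂ l₁ = tmul (dstar p') q') :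
    f.phi (hx₁₂.trans hx₂₃) l₃ l₁ = tmul (dstar (G.mul p p')) (K.mul q q') :=
  f.φ_mul _ _ _ _ _ _ _ _ _ _ _ _ _ _ _ _ _ _ _ _ e e'

theorem phi_left_bijective {h₁ : G.π x₁ = K.π y₁} {h₂ : G.π x₂ = K.π y₂} (hx : G.π x₁ = G.π x₂)
    (l₁ : f.fib h₁) : Function.Bijective fun l₂ : f.fib h₂ => f.phi hx l₂ l₁ :=
  bijective_of_map_smul fun c l₂ => f.phi_smul_left hx c l₂ l₁

theorem phi_right_bijective {h₁ : G.π x₁ = K.π y₁} {h₂ : G.π x₂ = K.π y₂} (hx : G.π x₁ = G.π x₂)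
    (l₂ : f.fib h₂) : Function.Bijective fun l₁ : f.fib h₁ => f.phi hx l₂ l₁ := by
  have hΦ : Function.Bijective fun l₁ : DualTorsor (f.fib h₁) => f.phi hx l₂ l₁.undstar :=
    bijective_of_map_smul fun c l₁ => by
      rw [← inv_inv c, ← phi_smul_right]; rfl
  exact hΦ.comp (f := dstar) ⟨fun _ _ => DualTorsor.dstar.inj, fun l => ⟨l.undstar, rfl⟩⟩

/-- The left action `Q(y₁, y₂) ⊗ L_f(x, y₁) → L_f(x, y₂)`. -/
def lact {h : G.π x = K.π y₁} {hy : K.π y₁ = K.π y₂} (q : K.fib hy) (a : f.fib h) :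
    f.fib (h.trans hy) :=
  Function.surjInv (f.phi_left_bijective rfl a).2 (tmul (dstar (G.one x)) q)

/-- The right action `L_f(x₂, y) ⊗ P(x₁, x₂) → L_f(x₁, y)`. -/
def ract {h : G.π x₂ = K.π y} {hx : G.π x₁ = G.π x₂} (a : f.fib h) (p : G.fib hx) :
    f.fib (hx.trans h) :=
  Function.surjInv (f.phi_right_bijective hx a).2 (tmul (dstar p) (K.one y))

theorem phi_lact {h : G.π x = K.π y₁} {hy : K.π y₁ = K.π y₂} (q : K.fib hy) (a : f.fib h) :
    f.phi rfl (f.lact q a) a = tmul (dstar (G.one x)) q :=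
  Function.surjInv_eq (f.phi_left_bijective rfl a).2 _

theorem phi_ract {h : G.π x₂ = K.π y} {hx : G.π x₁ = G.π x₂} (a : f.fib h) (p : G.fib hx) :
    f.phi hx a (f.ract a p) = tmul (dstar p) (K.one y) :=
  Function.surjInv_eq (f.phi_right_bijective hx a).2 _

theorem eq_lact_of_phi_eq {h : G.π x = K.π y₁} {hy : K.π y₁ = K.π y₂} {q : K.fib hy}
    {a : f.fib h} {a' : f.fib (h.trans hy)}
    (e : f.phi rfl a' a = tmul (dstar (G.one x)) q) : a' = f.lact q a :=
  (f.phi_left_bijective rfl a).1 (e.trans (f.phi_lact q a).symm)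

theorem eq_ract_of_phi_eq {h : G.π x₂ = K.π y} {hx : G.π x₁ = G.π x₂} {a : f.fib h}
    {p : G.fib hx} {a' : f.fib (hx.trans h)}
    (e : f.phi hx a a' = tmul (dstar p) (K.one y)) : a' = f.ract a p :=
  (f.phi_right_bijective hx a).1 (e.trans (f.phi_ract a p).symm)

theorem lact_smul {h : G.π x = K.π y₁} {hy : K.π y₁ = K.π y₂} (c : ℂˣ) (q : K.fib hy)
    (a : f.fib h) : f.lact q (c • a) = c • f.lact q a :=
  (f.eq_lact_of_phi_eq (by rw [phi_smul_left, phi_smul_right, phi_lact, smul_inv_smul])).symm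

theorem smul_lact {h : G.π x = K.π y₁} {hy : K.π y₁ = K.π y₂} (c : ℂˣ) (q : K.fib hy)
    (a : f.fib h) : f.lact (c • q) a = c • f.lact q a :=
  (f.eq_lact_of_phi_eq (by rw [phi_smul_left, phi_lact, smul_tmul_right])).symm

theorem smul_ract {h : G.π x₂ = K.π y} {hx : G.π x₁ = G.π x₂} (c : ℂˣ) (a : f.fib h)
    (p : G.fib hx) : f.ract (c • a) p = c • f.ract a p :=
  (f.eq_ract_of_phi_eq (by rw [phi_smul_left, phi_smul_right, phi_ract, smul_inv_smul])).symm

theorem ract_smul {h : G.π x₂ = K.π y} {hx : G.π x₁ = G.π x₂} (c : ℂˣ) (a : f.fib h)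
    (p : G.fib hx) : f.ract a (c • p) = c • f.ract a p :=
  (f.eq_ract_of_phi_eq
    (by rw [phi_smul_right, phi_ract, smul_tmul, smul_dstar, _root_.inv_inv])).symm

theorem lact_lact {h : G.π x = K.π y₁} {hy : K.π y₁ = K.π y₂} {hy' : K.π y₂ = K.π y₃}
    (q' : K.fib hy') (q : K.fib hy) (a : f.fib h) :
    f.lact q' (f.lact q a) = f.lact (K.mul q' q) a :=
  f.eq_lact_of_phi_eq (by
    have := f.phi_mul (f.phi_lact q' (f.lact q a)) (f.phi_lact q a)
    rwa [G.one_mul] at this)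

theorem ract_ract {h : G.π x₃ = K.π y} {hx : G.π x₁ = G.π x₂} {hx' : G.π x₂ = G.π x₃}
    (a : f.fib h) (p' : G.fib hx') (p : G.fib hx) :
    f.ract (f.ract a p') p = f.ract a (G.mul p' p) :=
  f.eq_ract_of_phi_eq (by
    have := f.phi_mul (f.phi_ract a p') (f.phi_ract (f.ract a p') p)
    rwa [K.one_mul] at this)

theorem one_lact {h : G.π x = K.π y} (a : f.fib h) : f.lact (K.one y) a = a :=
  (bijective_of_map_smul fun c a => f.lact_smul c (K.one y) a).1 <|
    (f.lact_lact _ _ a).trans (by rw [K.one_mul])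

theorem ract_one {h : G.π x = K.π y} (a : f.fib h) : f.ract a (G.one x) = a :=
  (bijective_of_map_smul (Φ := fun a => f.ract a (G.one x)) fun c a => f.smul_ract c a _).1 <|
    (f.ract_ract a _ _).trans (by rw [G.one_mul])

theorem lact_left_bijective {h : G.π x = K.π y₁} {hy : K.π y₁ = K.π y₂} (a : f.fib h) :
    Function.Bijective fun q : K.fib hy => f.lact q a :=
  bijective_of_map_smul fun c q => f.smul_lact c q a

theorem ract_right_bijective {h : G.π x₂ = K.π y} {hx : G.π x₁ = G.π x₂} (a : f.fib h) :
    Function.Bijective fun p : G.fib hx => f.ract a p :=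
  bijective_of_map_smul fun c p => f.ract_smul c a p

theorem phi_eq_of_ract_eq {h₁ : G.π x₁ = K.π y₁} {h₂ : G.π x₂ = K.π y₂} {hx : G.π x₁ = G.π x₂}
    {hy : K.π y₁ = K.π y₂} {l₁ : f.fib h₁} {l₂ : f.fib h₂} {p : G.fib hx} {q : K.fib hy}
    (e : f.ract l₂ p = f.lact q l₁) : f.phi hx l₂ l₁ = tmul (dstar p) q := by
  have h := f.phi_mul (f.phi_ract l₂ p) (by rw [e]; exact f.phi_lact q l₁)
  rwa [G.mul_one, K.one_mul] at h

theorem phi_eq_iff {h₁ : G.π x₁ = K.π y₁} {h₂ : G.π x₂ = K.π y₂} {hx : G.π x₁ = G.π x₂}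
    {hy : K.π y₁ = K.π y₂} {l₁ : f.fib h₁} {l₂ : f.fib h₂} {p : G.fib hx} {q : K.fib hy} :
    f.phi hx l₂ l₁ = tmul (dstar p) q ↔ f.ract l₂ p = f.lact q l₁ := by
  refine ⟨fun h => ?_, f.phi_eq_of_ract_eq⟩
  obtain ⟨q', hq' : f.lact q' l₁ = f.ract l₂ p⟩ := (f.lact_left_bijective l₁).2 (f.ract l₂ p)
  rw [tmul_left_cancel (h.symm.trans (f.phi_eq_of_ract_eq hq'.symm)), hq']

theorem lact_ract {h : G.π x₂ = K.π y₁} {hx : G.π x₁ = G.π x₂} {hy : K.π y₁ = K.π y₂}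
    (q : K.fib hy) (a : f.fib h) (p : G.fib hx) :
    f.lact q (f.ract a p) = f.ract (f.lact q a) p := by
  refine (f.phi_eq_iff.1 ?_).symm
  have := f.phi_mul (f.phi_lact q a) (f.phi_ract a p)
  rwa [G.one_mul, K.mul_one] at this

end Algebra

variable (J) in
/-- Smoothness at `b` of a section `l` of `L_f` along a map `(x, y) : T → X ×_M Y`. -/
abbrev Smooth {x : T → G.X} {y : T → K.X} {h : ∀ q, G.π (x q) = K.π (y q)}
    (l : ∀ q, f.fib (h q)) (b : T) : Prop :=
  SmoothAlong J f.L (fun q => ⟨(x q, y q), h q⟩) l b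

theorem exists_smooth {x : T → G.X} {y : T → K.X} (hx : SmoothMapAt J G.I x b)
    (hy : SmoothMapAt J K.I y b) (h : ∀ q, G.π (x q) = K.π (y q)) :
    ∃ l : ∀ q, f.fib (h q), f.Smooth J l b :=
  f.L.exists_smoothAlong (k := fun q => ⟨(x q, y q), h q⟩) (hx.prodMk hy)

variable {f}

section

variable {x x₁ x₂ : T → G.X} {y y₁ y₂ : T → K.X} {h₁ : ∀ q, G.π (x₁ q) = K.π (y₁ q)}
  {h₂ : ∀ q, G.π (x₂ q) = K.π (y₂ q)} {hx : ∀ q, G.π (x₁ q) = G.π (x₂ q)}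
  {hy : ∀ q, K.π (y₁ q) = K.π (y₂ q)}

theorem Smooth.phi {l₂ : ∀ q, f.fib (h₂ q)} {l₁ : ∀ q, f.fib (h₁ q)} (hl₂ : f.Smooth J l₂ b)
    (hl₁ : f.Smooth J l₁ b) :
    SmoothAlong J (dualTensor G K)
      (fun q => ⟨((x₁ q, y₁ q), (x₂ q, y₂ q)), h₁ q, h₂ q, hx q⟩)
      (fun q => f.phi (hx q) (l₂ q) (l₁ q)) b := by
  have hk : SmoothMapAt J ((G.I.prod K.I).prod (G.I.prod K.I))
      (fun q => ((x₁ q, y₁ q), (x₂ q, y₂ q))) b := hl₁.base.prodMk hl₂.base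
  exact SmoothAlong.iso_map f.φ
    (k := fun q => (⟨((x₁ q, y₁ q), (x₂ q, y₂ q)), h₁ q, h₂ q, hx q⟩ : G.fpSq K.toLocallySplit))
    (SmoothAlong.tmul (SmoothAlong.pullback hk hl₂) (SmoothAlong.pullback hk hl₁).dstar)

theorem smooth_dualTensor {p : ∀ q, G.fib (hx q)} {s : ∀ q, K.fib (hy q)}
    (h₁ : ∀ q, G.π (x₁ q) = K.π (y₁ q)) (hp : G.Smooth J p b) (hs : K.Smooth J s b) :
    SmoothAlong J (dualTensor G K)
      (fun q => ⟨((x₁ q, y₁ q), (x₂ q, y₂ q)), h₁ q, (hx q).symm.trans ((h₁ q).trans (hy q)), hx q⟩)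
      (fun q => tmul (dstar (p q)) (s q)) b := by
  have hk : SmoothMapAt J ((G.I.prod K.I).prod (G.I.prod K.I))
      (fun q => ((x₁ q, y₁ q), (x₂ q, y₂ q))) b :=
    (hp.base.fst.prodMk hs.base.fst).prodMk (hp.base.snd.prodMk hs.base.snd)
  exact SmoothAlong.tmul (L := (G.P.pullback (G.fpSq K.toLocallySplit) _ _ _).dual)
    (L' := K.P.pullback (G.fpSq K.toLocallySplit) _ _ _)
    (SmoothAlong.dstar (SmoothAlong.pullback hk hp)) (SmoothAlong.pullback hk hs)

theorem Smooth.lact {h : ∀ q, G.π (x q) = K.π (y₁ q)} {s : ∀ q, K.fib (hy q)}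
    {a : ∀ q, f.fib (h q)} (hs : K.Smooth J s b) (ha : f.Smooth J a b) :
    f.Smooth J (fun q => f.lact (s q) (a q)) b := by
  refine SmoothAlong.of_map (L' := dualTensor G K)
    (k' := fun q => ⟨((x q, y₁ q), (x q, y₂ q)), h q, (h q).trans (hy q), rfl⟩)
    (Φ := fun q l => f.phi rfl l (a q)) (fun q c l => f.phi_smul_left rfl c l (a q))
    (fun t ht => Smooth.phi ht ha) (ha.base.fst.prodMk hs.base.snd) ?_
  exact (smooth_dualTensor h (BundleGerbe.smooth_one ha.base.fst) hs).congr fun q =>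
    (f.phi_lact (s q) (a q)).symm

theorem Smooth.ract {h : ∀ q, G.π (x₂ q) = K.π (y q)} {a : ∀ q, f.fib (h q)}
    {p : ∀ q, G.fib (hx q)} (ha : f.Smooth J a b) (hp : G.Smooth J p b) :
    f.Smooth J (fun q => f.ract (a q) (p q)) b := by
  refine SmoothAlong.of_dstar (SmoothAlong.of_map (L := f.L.dual) (L' := dualTensor G K)
    (k' := fun q => ⟨((x₁ q, y q), (x₂ q, y q)), (hx q).trans (h q), h q, hx q⟩)
    (Φ := fun q l => f.phi (hx q) (a q) l.undstar) (fun q c l => ?_)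
    (fun t ht => Smooth.phi ha (SmoothAlong.of_dstar ht)) (hp.base.fst.prodMk ha.base.snd) ?_)
  · change f.phi (hx q) (a q) (c⁻¹ • l.undstar) = _
    rw [phi_smul_right, inv_inv]
  · exact (smooth_dualTensor (fun q => (hx q).trans (h q)) hp
      (BundleGerbe.smooth_one ha.base.snd)).congr fun q => (f.phi_ract (a q) (p q)).symm

end

/-! ### Transformations as equivariant maps -/

section Transformations

variable {g k : StableMorphism G K} {x x₁ x₂ : G.X} {y y₁ y₂ : K.X}

/-- The map `L_f(x, y) → L_g(x, y)` given by a transformation `f ⇒ g`. -/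
def app (s : f ⟶ g) {h : G.π x = K.π y} (l : f.fib h) : g.fib h :=
  Classical.choose (exists_right (value s h) (dstar l))

theorem value_eq (s : f ⟶ g) {h : G.π x = K.π y} (l : f.fib h) :
    value s h = tmul (dstar l) (app s l) :=
  Classical.choose_spec (exists_right (value s h) (dstar l))

theorem value_eq_iff {s : f ⟶ g} {h : G.π x = K.π y} {l : f.fib h} {l' : g.fib h} :
    value s h = tmul (dstar l) l' ↔ app s l = l' := by
  rw [value_eq s l]
  exact ⟨tmul_left_cancel, fun e => by rw [e]⟩

theorem app_smul (s : f ⟶ g) {h : G.π x = K.π y} (c : ℂˣ) (l : f.fib h) :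
    app s (c • l) = c • app s l := by
  rw [← value_eq_iff, value_eq s l, ← smul_tmul_eq, smul_dstar, inv_smul_smul]

theorem app_id {h : G.π x = K.π y} (l : f.fib h) : app (𝟙 f) l = l :=
  value_eq_iff.1 (coev_eq l)

theorem app_comp (s : f ⟶ g) (t : g ⟶ k) {h : G.π x = K.π y} (l : f.fib h) :
    app (s ≫ t) l = app t (app s l) := by
  rw [← value_eq_iff]
  change contract (value s h) (value t h) = _
  rw [value_eq s l, value_eq t (app s l), contract_tmul]

theorem hom_ext {s t : f ⟶ g}
    (e : ∀ (x : G.X) (y : K.X) (h : G.π x = K.π y), ∃ l : f.fib h, app s l = app t l) :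
    s = t := by
  refine Transformation.ext (CBundle.Sect.ext (funext fun ⟨⟨x, y⟩, h⟩ => ?_))
  obtain ⟨l, hl⟩ := e x y h
  exact (value_eq s l).trans (by rw [hl, ← value_eq t l]; rfl)

theorem app_phi (s : f ⟶ g) {h₁ : G.π x₁ = K.π y₁} {h₂ : G.π x₂ = K.π y₂} (hx : G.π x₁ = G.π x₂)
    (l₂ : f.fib h₂) (l₁ : f.fib h₁) : g.phi hx (app s l₂) (app s l₁) = f.phi hx l₂ l₁ :=
  (Transformation.compat s _ _ _ _ _ _ hx _ _ _ _ (value_eq s l₁) (value_eq s l₂)).symm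

theorem app_lact (s : f ⟶ g) {h : G.π x = K.π y₁} {hy : K.π y₁ = K.π y₂} (q : K.fib hy)
    (a : f.fib h) : app s (f.lact q a) = g.lact q (app s a) :=
  g.eq_lact_of_phi_eq (by rw [app_phi, phi_lact])

theorem app_ract (s : f ⟶ g) {h : G.π x₂ = K.π y} {hx : G.π x₁ = G.π x₂} (a : f.fib h)
    (p : G.fib hx) : app s (f.ract a p) = g.ract (app s a) p :=
  g.eq_ract_of_phi_eq (by rw [app_phi, phi_ract])

theorem Smooth.app (s : f ⟶ g) {x : T → G.X} {y : T → K.X} {h : ∀ q, G.π (x q) = K.π (y q)}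
    {l : ∀ q, f.fib (h q)} (hl : f.Smooth J l b) : g.Smooth J (fun q => app s (l q)) b := by
  refine SmoothAlong.of_tmul_left hl.dstar
    ⟨hl.base, fun i hi => ?_⟩
  exact ((Transformation.θ s).smooth i ⟨(x b, y b), h b⟩ hi |>.comp
    (k := fun q => ⟨(x q, y q), h q⟩) hl.base).congr
    fun q => congrArg (· /ₛ (f.L.dual.tensor g.L).sec i ⟨(x q, y q), h q⟩) (value_eq s (l q))

/-- The transformation given by an isomorphism of bundles that commutes with the actions. -/
def ofIso (F : CBundle.Iso f.L g.L)
    (h_lact : ∀ {x : G.X} {y₁ y₂ : K.X} (h : G.π x = K.π y₁) (hy : K.π y₁ = K.π y₂)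
      (q : K.fib hy) (a : f.fib h),
      F.map ⟨(x, y₂), h.trans hy⟩ (f.lact q a) = g.lact q (F.map ⟨(x, y₁), h⟩ a))
    (h_ract : ∀ {x₁ x₂ : G.X} {y : K.X} (h : G.π x₂ = K.π y) (hx : G.π x₁ = G.π x₂)
      (a : f.fib h) (p : G.fib hx),
      F.map ⟨(x₁, y), hx.trans h⟩ (f.ract a p) = g.ract (F.map ⟨(x₂, y), h⟩ a) p) : f ⟶ g where
  θ := F.toSect
  compat x₁ x₂ y₁ y₂ h₁ h₂ hx l₁ l₂ k₁ k₂ e₁ e₂ := by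
    rw [F.toSect_val _ l₁] at e₁
    rw [F.toSect_val _ l₂] at e₂
    rw [← tmul_left_cancel e₁, ← tmul_left_cancel e₂]
    obtain ⟨p, q, e⟩ := exists_tmul (f.phi hx l₂ l₁)
    obtain ⟨p⟩ := p
    rw [e]
    refine (g.phi_eq_of_ract_eq ?_).symm
    rw [← h_ract, ← h_lact, f.phi_eq_iff.1 e]

theorem app_ofIso {F : CBundle.Iso f.L g.L} (h_lact h_ract) {h : G.π x = K.π y} (l : f.fib h) :
    app (ofIso F h_lact h_ract) l = F.map ⟨(x, y), h⟩ l :=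
  value_eq_iff.1 (F.toSect_val ⟨(x, y), h⟩ l)

theorem app_bijective (s : f ⟶ g) {h : G.π x = K.π y} :
    Function.Bijective fun l : f.fib h => app s l :=
  bijective_of_map_smul fun c l => app_smul s c l

/-- The inverse of the map `app s`. -/
def appInv (s : f ⟶ g) {h : G.π x = K.π y} : g.fib h → f.fib h :=
  Function.surjInv (app_bijective s).2

theorem app_appInv (s : f ⟶ g) {h : G.π x = K.π y} (l : g.fib h) : app s (appInv s l) = l :=
  Function.surjInv_eq (app_bijective s).2 l

theorem eq_appInv {s : f ⟶ g} {h : G.π x = K.π y} {l : f.fib h} {l' : g.fib h}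
    (e : app s l = l') : l = appInv s l' :=
  (app_bijective s).1 (e.trans (app_appInv s l').symm)

theorem appInv_smul (s : f ⟶ g) {h : G.π x = K.π y} (c : ℂˣ) (l : g.fib h) :
    appInv s (c • l) = c • appInv s l :=
  (eq_appInv (by rw [app_smul, app_appInv])).symm

theorem appInv_lact (s : f ⟶ g) {h : G.π x = K.π y₁} {hy : K.π y₁ = K.π y₂} (q : K.fib hy)
    (a : g.fib h) : appInv s (g.lact q a) = f.lact q (appInv s a) :=
  (eq_appInv (by rw [app_lact, app_appInv])).symm

theorem appInv_ract (s : f ⟶ g) {h : G.π x₂ = K.π y} {hx : G.π x₁ = G.π x₂} (a : g.fib h)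
    (p : G.fib hx) : appInv s (g.ract a p) = f.ract (appInv s a) p :=
  (eq_appInv (by rw [app_ract, app_appInv])).symm

/-- The bundle isomorphism inverse to a transformation. -/
def invIso (s : f ⟶ g) : CBundle.Iso g.L f.L :=
  .ofExists (fun b => appInv s (x := b.1.1) (y := b.1.2) (h := b.2)) (fun _ => appInv_smul s)
    fun b => by
      obtain ⟨l, hl⟩ := f.exists_smooth (J := G.I.prod K.I) (b := b) SmoothMapAt.val.fst
        SmoothMapAt.val.snd fun q => q.2
      exact ⟨_, hl.app s, hl.congr fun q => eq_appInv rfl⟩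

instance isIso (s : f ⟶ g) : IsIso s := by
  let t : g ⟶ f := ofIso (invIso s) (fun _ _ => appInv_lact s) (fun _ _ => appInv_ract s)
  have app_t {x : G.X} {y : K.X} {h : G.π x = K.π y} (l : g.fib h) : app t l = appInv s l :=
    app_ofIso _ _ l
  refine ⟨t, hom_ext fun x y h => ⟨Classical.arbitrary _, ?_⟩,
    hom_ext fun x y h => ⟨Classical.arbitrary _, ?_⟩⟩
  · rw [app_comp, app_t, app_id, ← eq_appInv rfl]
  · rw [app_comp, app_t, app_id, app_appInv]

end Transformations

end StableMorphism

/-! ## Stable morphisms from bimodules -/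

/-- A `ℂˣ`-bundle on `X ×_M Y` with commuting actions of `K` from the left and of `G` from the
right, where `X` and `Y` are the spaces of `G` and `K`. -/
structure Bimodule (G K : BundleGerbe E M) where
  L : CBundle (G.I.prod K.I) (G.fp K.toLocallySplit)
  lact {x : G.X} {y₁ y₂ : K.X} {h : G.π x = K.π y₁} {hy : K.π y₁ = K.π y₂} (q : K.fib hy)
    (a : L.Fib ⟨(x, y₁), h⟩) : L.Fib ⟨(x, y₂), h.trans hy⟩
  ract {x₁ x₂ : G.X} {y : K.X} {h : G.π x₂ = K.π y} {hx : G.π x₁ = G.π x₂}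
    (a : L.Fib ⟨(x₂, y), h⟩) (p : G.fib hx) : L.Fib ⟨(x₁, y), hx.trans h⟩
  lact_smul {x : G.X} {y₁ y₂ : K.X} {h : G.π x = K.π y₁} {hy : K.π y₁ = K.π y₂} (c : ℂˣ)
    (q : K.fib hy) (a : L.Fib ⟨(x, y₁), h⟩) : lact q (c • a) = c • lact q a
  smul_lact {x : G.X} {y₁ y₂ : K.X} {h : G.π x = K.π y₁} {hy : K.π y₁ = K.π y₂} (c : ℂˣ)
    (q : K.fib hy) (a : L.Fib ⟨(x, y₁), h⟩) : lact (c • q) a = c • lact q a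
  smul_ract {x₁ x₂ : G.X} {y : K.X} {h : G.π x₂ = K.π y} {hx : G.π x₁ = G.π x₂} (c : ℂˣ)
    (a : L.Fib ⟨(x₂, y), h⟩) (p : G.fib hx) : ract (c • a) p = c • ract a p
  ract_smul {x₁ x₂ : G.X} {y : K.X} {h : G.π x₂ = K.π y} {hx : G.π x₁ = G.π x₂} (c : ℂˣ)
    (a : L.Fib ⟨(x₂, y), h⟩) (p : G.fib hx) : ract a (c • p) = c • ract a p
  lact_lact {x : G.X} {y₁ y₂ y₃ : K.X} {h : G.π x = K.π y₁} {hy : K.π y₁ = K.π y₂}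
    {hy' : K.π y₂ = K.π y₃} (q' : K.fib hy') (q : K.fib hy) (a : L.Fib ⟨(x, y₁), h⟩) :
    lact q' (lact q a) = lact (K.mul q' q) a
  ract_ract {x₁ x₂ x₃ : G.X} {y : K.X} {h : G.π x₃ = K.π y} {hx : G.π x₁ = G.π x₂}
    {hx' : G.π x₂ = G.π x₃} (a : L.Fib ⟨(x₃, y), h⟩) (p' : G.fib hx') (p : G.fib hx) :
    ract (ract a p') p = ract a (G.mul p' p)
  lact_ract {x₁ x₂ : G.X} {y₁ y₂ : K.X} {h : G.π x₂ = K.π y₁} {hx : G.π x₁ = G.π x₂}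
    {hy : K.π y₁ = K.π y₂} (q : K.fib hy) (a : L.Fib ⟨(x₂, y₁), h⟩) (p : G.fib hx) :
    lact q (ract a p) = ract (lact q a) p
  one_lact {x : G.X} {y : K.X} {h : G.π x = K.π y} (a : L.Fib ⟨(x, y), h⟩) :
    lact (K.one y) a = a
  ract_one {x : G.X} {y : K.X} {h : G.π x = K.π y} (a : L.Fib ⟨(x, y), h⟩) :
    ract a (G.one x) = a
  smooth_lact {E' H' N' : Type u} [NormedAddCommGroup E'] [NormedSpace ℝ E'] [TopologicalSpace H']
    {J : ModelWithCorners ℝ E' H'} [TopologicalSpace N'] [ChartedSpace H' N'] {T : Set N'} {b : T}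
    {x : T → G.X} {y₁ y₂ : T → K.X} {h : ∀ t, G.π (x t) = K.π (y₁ t)}
    {hy : ∀ t, K.π (y₁ t) = K.π (y₂ t)} {q : ∀ t, K.fib (hy t)}
    {a : ∀ t, L.Fib ⟨(x t, y₁ t), h t⟩} : K.Smooth J q b → SmoothAlong J L _ a b →
    SmoothAlong J L _ (fun t => lact (q t) (a t)) b
  smooth_ract {E' H' N' : Type u} [NormedAddCommGroup E'] [NormedSpace ℝ E'] [TopologicalSpace H']
    {J : ModelWithCorners ℝ E' H'} [TopologicalSpace N'] [ChartedSpace H' N'] {T : Set N'} {b : T}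
    {x₁ x₂ : T → G.X} {y : T → K.X} {h : ∀ t, G.π (x₂ t) = K.π (y t)}
    {hx : ∀ t, G.π (x₁ t) = G.π (x₂ t)} {a : ∀ t, L.Fib ⟨(x₂ t, y t), h t⟩}
    {p : ∀ t, G.fib (hx t)} : SmoothAlong J L _ a b → G.Smooth J p b →
    SmoothAlong J L _ (fun t => ract (a t) (p t)) b

namespace Bimodule

variable {G K : BundleGerbe E M} (B : Bimodule G K)

variable {x x₁ x₂ : G.X} {y y₁ y₂ : K.X} {h₁ : G.π x₁ = K.π y₁} {h₂ : G.π x₂ = K.π y₂}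
  {hx : G.π x₁ = G.π x₂} {hy : K.π y₁ = K.π y₂}

theorem lact_left_bijective {h : G.π x = K.π y₁} (a : B.L.Fib ⟨(x, y₁), h⟩) :
    Function.Bijective fun q : K.fib hy => B.lact q a :=
  bijective_of_map_smul fun c q => B.smul_lact c q a

/-- The element `q` of `Q(y₁, y₂)` with `q a = a'`. -/
def ldiv {h : G.π x = K.π y₁} {h' : G.π x = K.π y₂} (a : B.L.Fib ⟨(x, y₁), h⟩)
    (a' : B.L.Fib ⟨(x, y₂), h'⟩) : K.fib (h.symm.trans h') :=
  Function.surjInv (B.lact_left_bijective a).2 a'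

theorem ldiv_lact {h : G.π x = K.π y₁} {h' : G.π x = K.π y₂} (a : B.L.Fib ⟨(x, y₁), h⟩)
    (a' : B.L.Fib ⟨(x, y₂), h'⟩) : B.lact (B.ldiv a a') a = a' :=
  Function.surjInv_eq (B.lact_left_bijective a).2 a'

theorem eq_ldiv {h : G.π x = K.π y₁} {h' : G.π x = K.π y₂} {a : B.L.Fib ⟨(x, y₁), h⟩}
    {a' : B.L.Fib ⟨(x, y₂), h'⟩} {q : K.fib (h.symm.trans h')} (e : B.lact q a = a') :
    q = B.ldiv a a' :=
  (B.lact_left_bijective a).1 (e.trans (B.ldiv_lact a a').symm)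

theorem ldiv_smul {h : G.π x = K.π y₁} {h' : G.π x = K.π y₂} (c : ℂˣ)
    (a : B.L.Fib ⟨(x, y₁), h⟩) (a' : B.L.Fib ⟨(x, y₂), h'⟩) :
    B.ldiv a (c • a') = c • B.ldiv a a' :=
  (B.eq_ldiv (by rw [B.smul_lact, B.ldiv_lact])).symm

theorem smul_ldiv {h : G.π x = K.π y₁} {h' : G.π x = K.π y₂} (c : ℂˣ)
    (a : B.L.Fib ⟨(x, y₁), h⟩) (a' : B.L.Fib ⟨(x, y₂), h'⟩) :
    B.ldiv (c • a) a' = c⁻¹ • B.ldiv a a' :=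
  (B.eq_ldiv (by rw [B.smul_lact, B.lact_smul, B.ldiv_lact, inv_smul_smul])).symm

/-- The map `L(x₂, y₂) ⊗ L(x₁, y₁)* → P(x₁, x₂)* ⊗ Q(y₁, y₂)` that sends `l₂ ⊗ l₁*` to `p* ⊗ q` with
`l₂ p = q l₁`, for an arbitrary choice of `p`. -/
def phi (h₁ : G.π x₁ = K.π y₁) (h₂ : G.π x₂ = K.π y₂) (hx : G.π x₁ = G.π x₂) :
    TensorTorsor (B.L.Fib ⟨(x₂, y₂), h₂⟩) (DualTorsor (B.L.Fib ⟨(x₁, y₁), h₁⟩)) →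
      TensorTorsor (DualTorsor (G.fib hx)) (K.fib (h₁.symm.trans (hx.trans h₂))) :=
  let p : G.fib hx := Classical.arbitrary _
  lift (fun l₂ l₁ => tmul (dstar p) (B.ldiv l₁.undstar (B.ract l₂ p))) fun c l₂ l₁ => by
    change _ = tmul _ (B.ldiv (c⁻¹ • l₁.undstar) _)
    rw [B.smul_ract, B.ldiv_smul, B.smul_ldiv, inv_inv]

theorem phi_smul (c : ℂˣ)
    (t : TensorTorsor (B.L.Fib ⟨(x₂, y₂), h₂⟩) (DualTorsor (B.L.Fib ⟨(x₁, y₁), h₁⟩))) :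
    B.phi h₁ h₂ hx (c • t) = c • B.phi h₁ h₂ hx t := by
  obtain ⟨l₂, l₁, rfl⟩ := exists_tmul t
  rw [smul_tmul, phi, lift_tmul, lift_tmul, B.smul_ract, B.ldiv_smul, smul_tmul_right]

theorem phi_tmul (l₂ : B.L.Fib ⟨(x₂, y₂), h₂⟩) (l₁ : B.L.Fib ⟨(x₁, y₁), h₁⟩) (p : G.fib hx) :
    B.phi h₁ h₂ hx (tmul l₂ (dstar l₁)) = tmul (dstar p) (B.ldiv l₁ (B.ract l₂ p)) := by
  rw [phi, lift_tmul]
  generalize Classical.arbitrary (G.fib hx) = p₀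
  obtain ⟨c, rfl⟩ : ∃ c : ℂˣ, p₀ = c • p := ⟨_, (sdiv_smul p₀ p).symm⟩
  rw [B.ract_smul, B.ldiv_smul, ← smul_tmul_eq, smul_dstar, inv_smul_smul]

theorem phi_eq_iff {l₁ : B.L.Fib ⟨(x₁, y₁), h₁⟩} {l₂ : B.L.Fib ⟨(x₂, y₂), h₂⟩} {p : G.fib hx}
    {s : K.fib hy} :
    B.phi h₁ h₂ hx (tmul l₂ (dstar l₁)) = tmul (dstar p) s ↔ B.ract l₂ p = B.lact s l₁ := by
  rw [B.phi_tmul l₂ l₁ p]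
  exact ⟨fun e => by rw [← tmul_left_cancel e, ldiv_lact], fun e => by rw [B.eq_ldiv e.symm]⟩

/-- The stable morphism given by a bimodule. -/
def toStableMorphism : StableMorphism G K where
  L := B.L
  φ := .ofExists (fun b => B.phi b.2.1 b.2.2.1 b.2.2.2) (fun _ => B.phi_smul) fun b => by
    have hb := SmoothMapAt.val (J := (G.I.prod K.I).prod (G.I.prod K.I)) (p := b)
    obtain ⟨p, hp⟩ := G.exists_smooth hb.fst.fst hb.snd.fst fun q => q.2.2.2
    obtain ⟨s, hs⟩ := K.exists_smooth hb.fst.snd hb.snd.snd fun q =>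
      q.2.1.symm.trans (q.2.2.2.trans q.2.2.1)
    obtain ⟨l₁, hl₁⟩ := B.L.exists_smoothAlong
      (k := fun q : G.fpSq K.toLocallySplit => ⟨(q.1.1.1, q.1.1.2), q.2.1⟩)
      (hb.fst.fst.prodMk hb.fst.snd)
    let l₂ (q : G.fpSq K.toLocallySplit) : B.L.Fib ⟨(q.1.2.1, q.1.2.2), q.2.2.1⟩ :=
      B.ract (hx := q.2.2.2.symm) (B.lact (h := q.2.1) (s q) (l₁ q)) (G.inv (p q))
    have hl₂ : SmoothAlong _ B.L (fun q => ⟨(q.1.2.1, q.1.2.2), q.2.2.1⟩) l₂ b :=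
      B.smooth_ract (B.smooth_lact hs hl₁) hp.inv
    refine ⟨fun q => tmul (l₂ q) (dstar (l₁ q)),
      SmoothAlong.tmul (SmoothAlong.pullback hb hl₂) (SmoothAlong.pullback hb hl₁).dstar,
      (StableMorphism.smooth_dualTensor (fun q => q.2.1) hp hs).congr fun q =>
        (B.phi_eq_iff.2 ?_).symm⟩
    rw [B.ract_ract, G.inv_mul, B.ract_one]
  φ_mul x₁ x₂ x₃ y₁ y₂ y₃ h₁ h₂ h₃ hx₁₂ hx₂₃ hy₁₂ hy₂₃ l₁ l₂ l₃ p p' q q' e e' := by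
    replace e := B.phi_eq_iff.1 e
    replace e' := B.phi_eq_iff.1 e'
    refine B.phi_eq_iff.2 ?_
    rw [← B.ract_ract, e, ← B.lact_ract, e', B.lact_lact]

theorem toStableMorphism_lact {h : G.π x = K.π y₁} (q : K.fib hy) (a : B.L.Fib ⟨(x, y₁), h⟩) :
    B.toStableMorphism.lact q a = B.lact q a :=
  (B.toStableMorphism.eq_lact_of_phi_eq (q := q) (a := a) (a' := B.lact q a)
    (B.phi_eq_iff.2 (B.ract_one _))).symm

theorem toStableMorphism_ract {h : G.π x₂ = K.π y} (a : B.L.Fib ⟨(x₂, y), h⟩) (p : G.fib hx) :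
    B.toStableMorphism.ract a p = B.ract a p :=
  (B.toStableMorphism.eq_ract_of_phi_eq (p := p) (a := a) (a' := B.ract a p)
    (B.phi_eq_iff.2 (B.one_lact _).symm)).symm

end Bimodule

namespace LocallySplit

/-- A chosen point over `m`. -/
def pt (A : LocallySplit E M) (m : M) : A.X := Function.surjInv A.surjective_π m

theorem π_pt (A : LocallySplit E M) (m : M) : A.π (A.pt m) = m := Function.surjInv_eq _ _

theorem smooth_section (A B : LocallySplit E M) {σ : M → B.X} {x : T → A.X}
    (hσ : ∀ᶠ m in 𝓝 (A.π (x b)), ContMDiffAt 𝓘(ℝ, E) B.I ∞ σ m) (hx : SmoothMapAt J A.I x b) :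
    SmoothMapAt J B.I (fun q => σ (A.π (x q))) b :=
  (hx.comp_contMDiff A.smooth_π).comp hσ

theorem exists_smooth_lift (A B : LocallySplit E M) {x : T → A.X} (hx : SmoothMapAt J A.I x b) :
    ∃ y : T → B.X, (∀ q, A.π (x q) = B.π (y q)) ∧ SmoothMapAt J B.I y b :=
  let ⟨_, e, hσ⟩ := B.exists_section (A.π (x b))
  ⟨_, fun _ => (e _).symm, smooth_section A B hσ hx⟩

end LocallySplit

namespace StableMorphism

variable {G K R : BundleGerbe E M} (f : StableMorphism G K) (g : StableMorphism K R)

theorem smooth_sec {x : T → G.X} {y : T → K.X} {h : ∀ q, G.π (x q) = K.π (y q)}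
    (hx : SmoothMapAt J G.I x b) (hy : SmoothMapAt J K.I y b) {i : f.L.Idx}
    (hi : (⟨(x b, y b), h b⟩ : G.fp K.toLocallySplit) ∈ f.L.U i) :
    f.Smooth J (fun q => f.L.sec i ⟨(x q, y q), h q⟩) b :=
  SmoothAlong.sec (hx.prodMk hy) hi

/-! ## The bundle of a composite -/

/-- The fibre of `L_(g ∘ f)` at `(x, z)`, defined by means of a chosen point of `Y`. -/
abbrev CompFib {x : G.X} {z : R.X} (h : G.π x = R.π z) : Type u :=
  TensorTorsor (f.fib (x := x) (y := K.pt (G.π x)) (K.π_pt _).symm)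
    (g.fib (x := K.pt (G.π x)) (y := z) ((K.π_pt _).trans h))

namespace CompFib

variable {f g} {x : G.X} {y y' : K.X} {z : R.X} {h₁ : G.π x = K.π y} {h₂ : K.π y = R.π z}
  {h₁' : G.π x = K.π y'} {h₂' : K.π y' = R.π z}

/-- The element of `L_(g ∘ f)(x, z)` given by elements of `L_f(x, y)` and of `L_g(y, z)`. -/
def pair (a : f.fib h₁) (c : g.fib h₂) : CompFib f g (h₁.trans h₂) :=
  let s : K.fib (h₁.symm.trans (K.π_pt (G.π x)).symm) := Classical.arbitrary _
  tmul (f.lact s a) (g.ract c (K.inv s))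

theorem pair_smul (d : ℂˣ) (a : f.fib h₁) (c : g.fib h₂) : pair a (d • c) = d • pair a c := by
  rw [pair, pair, smul_ract, smul_tmul_right]

theorem smul_pair (d : ℂˣ) (a : f.fib h₁) (c : g.fib h₂) : pair (d • a) c = d • pair a c := by
  rw [pair, pair, lact_smul, smul_tmul]

theorem pair_eq (s : K.fib (h₁.symm.trans (K.π_pt (G.π x)).symm)) (a : f.fib h₁) (c : g.fib h₂) :
    pair a c = tmul (f.lact s a) (g.ract c (K.inv s)) := by
  rw [pair]
  generalize Classical.arbitrary (K.fib (h₁.symm.trans (K.π_pt (G.π x)).symm)) = s'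
  rw [← sdiv_smul s' s, smul_lact, K.inv_smul, ract_smul, smul_tmul_inv_smul]

theorem pair_lact {hy : K.π y = K.π y'} (q : K.fib hy) (a : f.fib h₁) (c : g.fib h₂') :
    pair (f.lact q a) c = pair a (g.ract c q) := by
  let s : K.fib ((h₁.trans hy).symm.trans (K.π_pt (G.π x)).symm) := Classical.arbitrary _
  rw [pair_eq s, pair_eq (K.mul s q) a, lact_lact, ract_ract, K.inv_mul_rev, ← K.mul_assoc,
    K.mul_inv, K.one_mul]

theorem pair_sdiv_pair (s : K.fib (h₁.symm.trans h₁')) (a : f.fib h₁) (c : g.fib h₂)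
    (a' : f.fib h₁') (c' : g.fib h₂') :
    pair a c /ₛ pair a' c' = (f.lact s a /ₛ a') * (c /ₛ g.ract c' s) := by
  obtain ⟨d, hd⟩ : ∃ d : ℂˣ, c = d • g.ract c' s := ⟨_, (sdiv_smul _ _).symm⟩
  obtain ⟨e, he⟩ : ∃ e : ℂˣ, f.lact s a = e • a' := ⟨_, (sdiv_smul _ _).symm⟩
  rw [hd, pair_smul, ← pair_lact, he, smul_pair, smul_sdiv, smul_sdiv, smul_sdiv_assoc, smul_sdiv,
    mul_comm]

/-- The map out of `L_(g ∘ f)(x, z)` given by a family of maps that is balanced over `Q`. -/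
def desc {C : Type v} (h : G.π x = R.π z)
    (F : ∀ {y : K.X} (h₁ : G.π x = K.π y) (h₂ : K.π y = R.π z), f.fib h₁ → g.fib h₂ → C)
    (hF : ∀ {y y' : K.X} (h₁ : G.π x = K.π y) (hy : K.π y = K.π y') (h₂ : K.π y' = R.π z)
      (q : K.fib hy) (a : f.fib h₁) (c : g.fib h₂),
      F (h₁.trans hy) h₂ (f.lact q a) c = F h₁ (hy.trans h₂) a (g.ract c q)) :
    CompFib f g h → C :=
  TensorTorsor.lift (F (K.π_pt _).symm ((K.π_pt _).trans h)) fun d a c => by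
    have e := hF (K.π_pt _).symm rfl ((K.π_pt _).trans h) (d • K.one _) a c
    rwa [f.smul_lact, f.one_lact, g.ract_smul, g.ract_one] at e

theorem desc_pair {C : Type v}
    {F : ∀ {y : K.X} (h₁ : G.π x = K.π y) (h₂ : K.π y = R.π z), f.fib h₁ → g.fib h₂ → C}
    (hF : ∀ {y y' : K.X} (h₁ : G.π x = K.π y) (hy : K.π y = K.π y') (h₂ : K.π y' = R.π z)
      (q : K.fib hy) (a : f.fib h₁) (c : g.fib h₂),
      F (h₁.trans hy) h₂ (f.lact q a) c = F h₁ (hy.trans h₂) a (g.ract c q))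
    (a : f.fib h₁) (c : g.fib h₂) : desc (h₁.trans h₂) F hF (pair a c) = F h₁ h₂ a c := by
  let s : K.fib (h₁.symm.trans (K.π_pt (G.π x)).symm) := Classical.arbitrary _
  rw [pair_eq s, desc, lift_tmul, hF h₁, ract_ract, K.inv_mul, ract_one]

theorem exists_eq_pair {h : G.π x = R.π z} (t : CompFib f g h) :
    ∃ (y : K.X) (h₁ : G.π x = K.π y) (h₂ : K.π y = R.π z) (a : f.fib h₁) (c : g.fib h₂),
      t = pair a c := by
  let h₁ : G.π x = K.π (K.pt (G.π x)) := (K.π_pt _).symm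
  let a : f.fib h₁ := Classical.arbitrary _
  obtain ⟨c, hc⟩ := (bijective_of_map_smul (Φ := fun c : g.fib (h₁.symm.trans h) => pair a c)
    fun d c => pair_smul d a c).2 t
  exact ⟨_, _, _, a, c, hc.symm⟩

/-- The left action on `L_(g ∘ f)`. -/
def lact {z' : R.X} {h : G.π x = R.π z} {hz : R.π z = R.π z'} (r : R.fib hz)
    (t : CompFib f g h) : CompFib f g (h.trans hz) :=
  desc h (fun _ _ a c => (pair a (g.lact r c) : CompFib f g (h.trans hz)))
    (fun _ _ _ q a c => by rw [pair_lact, lact_ract]) t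

/-- The right action on `L_(g ∘ f)`. -/
def ract {x' : G.X} {h : G.π x = R.π z} {hx : G.π x' = G.π x} (t : CompFib f g h)
    (p : G.fib hx) : CompFib f g (hx.trans h) :=
  desc h (fun _ _ a c => (pair (f.ract a p) c : CompFib f g (hx.trans h)))
    (fun _ _ _ q a c => by rw [← lact_ract, pair_lact]) t

theorem lact_pair {z' : R.X} {hz : R.π z = R.π z'} (r : R.fib hz) (a : f.fib h₁)
    (c : g.fib h₂) : lact r (pair a c) = pair a (g.lact r c) :=
  desc_pair (fun _ _ _ q a c => by rw [pair_lact, lact_ract]) a c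

theorem pair_ract {x' : G.X} {hx : G.π x' = G.π x} (a : f.fib h₁) (c : g.fib h₂)
    (p : G.fib hx) : ract (pair a c) p = pair (f.ract a p) c :=
  desc_pair (fun _ _ _ q a c => by rw [← lact_ract, pair_lact]) a c

theorem lact_smul {z' : R.X} {h : G.π x = R.π z} {hz : R.π z = R.π z'} (d : ℂˣ) (r : R.fib hz)
    (t : CompFib f g h) : lact r (d • t) = d • lact r t := by
  obtain ⟨y, h₁, h₂, a, c, rfl⟩ := exists_eq_pair t
  rw [← smul_pair, lact_pair, lact_pair, smul_pair]

theorem smul_lact {z' : R.X} {h : G.π x = R.π z} {hz : R.π z = R.π z'} (d : ℂˣ) (r : R.fib hz)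
    (t : CompFib f g h) : lact (d • r) t = d • lact r t := by
  obtain ⟨y, h₁, h₂, a, c, rfl⟩ := exists_eq_pair t
  rw [lact_pair, lact_pair, g.smul_lact, pair_smul]

theorem smul_ract {x' : G.X} {h : G.π x = R.π z} {hx : G.π x' = G.π x} (d : ℂˣ)
    (t : CompFib f g h) (p : G.fib hx) : ract (d • t) p = d • ract t p := by
  obtain ⟨y, h₁, h₂, a, c, rfl⟩ := exists_eq_pair t
  rw [← pair_smul, pair_ract, pair_ract, pair_smul]

theorem ract_smul {x' : G.X} {h : G.π x = R.π z} {hx : G.π x' = G.π x} (d : ℂˣ)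
    (t : CompFib f g h) (p : G.fib hx) : ract t (d • p) = d • ract t p := by
  obtain ⟨y, h₁, h₂, a, c, rfl⟩ := exists_eq_pair t
  rw [pair_ract, pair_ract, f.ract_smul, smul_pair]

theorem lact_lact {z' z'' : R.X} {h : G.π x = R.π z} {hz : R.π z = R.π z'}
    {hz' : R.π z' = R.π z''} (r' : R.fib hz') (r : R.fib hz) (t : CompFib f g h) :
    lact r' (lact r t) = lact (R.mul r' r) t := by
  obtain ⟨y, h₁, h₂, a, c, rfl⟩ := exists_eq_pair t
  rw [lact_pair, lact_pair, lact_pair, g.lact_lact]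

theorem ract_ract {x' x'' : G.X} {h : G.π x = R.π z} {hx : G.π x' = G.π x}
    {hx' : G.π x'' = G.π x'} (t : CompFib f g h) (p' : G.fib hx) (p : G.fib hx') :
    ract (ract t p') p = ract t (G.mul p' p) := by
  obtain ⟨y, h₁, h₂, a, c, rfl⟩ := exists_eq_pair t
  rw [pair_ract, pair_ract, pair_ract, f.ract_ract]

theorem lact_ract {x' : G.X} {z' : R.X} {h : G.π x = R.π z} {hx : G.π x' = G.π x}
    {hz : R.π z = R.π z'} (r : R.fib hz) (t : CompFib f g h) (p : G.fib hx) :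
    lact r (ract t p) = ract (lact r t) p := by
  obtain ⟨y, h₁, h₂, a, c, rfl⟩ := exists_eq_pair t
  rw [pair_ract, lact_pair, lact_pair, pair_ract]

theorem one_lact {h : G.π x = R.π z} (t : CompFib f g h) : lact (R.one z) t = t := by
  obtain ⟨y, h₁, h₂, a, c, rfl⟩ := exists_eq_pair t
  rw [lact_pair, g.one_lact]

theorem ract_one {h : G.π x = R.π z} (t : CompFib f g h) : ract t (G.one x) = t := by
  obtain ⟨y, h₁, h₂, a, c, rfl⟩ := exists_eq_pair t
  rw [pair_ract, f.ract_one]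

end CompFib

open CompFib (pair pair_lact pair_smul smul_pair exists_eq_pair lact_pair pair_ract
  desc_pair pair_sdiv_pair)

theorem smooth_pair_sdiv_pair {x : T → G.X} {y y' : T → K.X} {z : T → R.X}
    {h₁ : ∀ q, G.π (x q) = K.π (y q)} {h₂ : ∀ q, K.π (y q) = R.π (z q)}
    {h₁' : ∀ q, G.π (x q) = K.π (y' q)} {h₂' : ∀ q, K.π (y' q) = R.π (z q)}
    {a : ∀ q, f.fib (h₁ q)} {c : ∀ q, g.fib (h₂ q)} {a' : ∀ q, f.fib (h₁' q)}
    {c' : ∀ q, g.fib (h₂' q)} (ha : f.Smooth J a b) (hc : g.Smooth J c b)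
    (ha' : f.Smooth J a' b) (hc' : g.Smooth J c' b) :
    SmoothAtOn J T (fun q => pair (a q) (c q) /ₛ pair (a' q) (c' q)) b := by
  obtain ⟨s, hs⟩ := K.exists_smooth hc.base.fst hc'.base.fst fun q => (h₁ q).symm.trans (h₁' q)
  exact (((Smooth.lact hs ha).sdiv ha').mul (hc.sdiv (Smooth.ract hc' hs))).congr fun q =>
    (pair_sdiv_pair (s q) (a q) (c q) (a' q) (c' q)).symm

/-- The bundle `L_(g ∘ f)` on `X ×_M Z`. -/
def compL : CBundle (G.I.prod R.I) (G.fp R.toLocallySplit) where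
  Fib b := CompFib f g (x := b.1.1) (z := b.1.2) b.2
  Idx := {σ : M → K.X // ∀ m, K.π (σ m) = m} × f.L.Idx × g.L.Idx
  U i := {b | (∀ᶠ m in 𝓝 (G.π b.1.1), ContMDiffAt 𝓘(ℝ, E) K.I ∞ i.1.1 m) ∧
    (⟨(b.1.1, i.1.1 (G.π b.1.1)), (i.1.2 _).symm⟩ : G.fp K.toLocallySplit) ∈ f.L.U i.2.1 ∧
    (⟨(i.1.1 (G.π b.1.1), b.1.2), (i.1.2 _).trans b.2⟩ : K.fp R.toLocallySplit) ∈ g.L.U i.2.2}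
  isOpen_U := by
    rintro ⟨⟨σ, e⟩, i, j⟩
    refine isOpen_iff_mem_nhds.2 fun b ⟨h₁, h₂, h₃⟩ => ?_
    have hb := SmoothMapAt.val (J := G.I.prod R.I) (p := b)
    have hσ := LocallySplit.smooth_section G.toLocallySplit K.toLocallySplit h₁ hb.fst
    have hk : ContinuousAt (fun q : G.fp R.toLocallySplit =>
        (⟨(q.1.1, σ (G.π q.1.1)), (e _).symm⟩ : G.fp K.toLocallySplit)) b :=
      Topology.IsInducing.subtypeVal.continuousAt_iff.2 (hb.fst.prodMk hσ).continuousAt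
    have hk' : ContinuousAt (fun q : G.fp R.toLocallySplit =>
        (⟨(σ (G.π q.1.1), q.1.2), (e _).trans q.2⟩ : K.fp R.toLocallySplit)) b :=
      Topology.IsInducing.subtypeVal.continuousAt_iff.2 (hσ.prodMk hb.snd).continuousAt
    filter_upwards [(hb.fst.comp_contMDiff G.smooth_π).continuousAt.eventually
      (eventually_eventually_nhds.2 h₁), hk.eventually ((f.L.isOpen_U i).mem_nhds h₂),
      hk'.eventually ((g.L.isOpen_U j).mem_nhds h₃)] with q q₁ q₂ q₃ using ⟨q₁, q₂, q₃⟩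
  cover b := by
    obtain ⟨σ, e, hσ⟩ := K.exists_section (G.π b.1.1)
    obtain ⟨i, hi⟩ := f.L.cover ⟨(b.1.1, σ (G.π b.1.1)), (e _).symm⟩
    obtain ⟨j, hj⟩ := g.L.cover ⟨(σ (G.π b.1.1), b.1.2), (e _).trans b.2⟩
    exact ⟨(⟨σ, e⟩, i, j), hσ, hi, hj⟩
  sec i b := pair (f.L.sec i.2.1 ⟨(b.1.1, i.1.1 (G.π b.1.1)), (i.1.2 _).symm⟩)
    (g.L.sec i.2.2 ⟨(i.1.1 (G.π b.1.1), b.1.2), (i.1.2 _).trans b.2⟩)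
  smooth_transition i j b hi hj := by
    have hb := SmoothMapAt.val (J := G.I.prod R.I) (p := b)
    have hσ := LocallySplit.smooth_section G.toLocallySplit K.toLocallySplit hi.1 hb.fst
    have hτ := LocallySplit.smooth_section G.toLocallySplit K.toLocallySplit hj.1 hb.fst
    exact smooth_pair_sdiv_pair f g (J := G.I.prod R.I)
      (f.smooth_sec hb.fst hσ hi.2.1) (g.smooth_sec hσ hb.snd hi.2.2)
      (f.smooth_sec hb.fst hτ hj.2.1) (g.smooth_sec hτ hb.snd hj.2.2)

variable {f g} in
theorem smooth_compL_pair {x : T → G.X} {y : T → K.X} {z : T → R.X}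
    {h₁ : ∀ q, G.π (x q) = K.π (y q)} {h₂ : ∀ q, K.π (y q) = R.π (z q)}
    {a : ∀ q, f.fib (h₁ q)} {c : ∀ q, g.fib (h₂ q)}
    (ha : f.Smooth J a b) (hc : g.Smooth J c b) :
    SmoothAlong J (compL f g) (fun q => ⟨(x q, z q), (h₁ q).trans (h₂ q)⟩)
      (fun q => pair (a q) (c q)) b := by
  refine ⟨ha.base.fst.prodMk hc.base.snd, fun i hi => ?_⟩
  have hσ := LocallySplit.smooth_section G.toLocallySplit K.toLocallySplit hi.1 ha.base.fst
  exact smooth_pair_sdiv_pair f g ha hc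
    (f.smooth_sec ha.base.fst hσ hi.2.1) (g.smooth_sec hσ hc.base.snd hi.2.2)

section

variable {x x' : T → G.X} {z z' : T → R.X} {h : ∀ q, G.π (x q) = R.π (z q)}

variable {f g} in
theorem exists_smooth_compL_pair (hx : SmoothMapAt J G.I x b) (hz : SmoothMapAt J R.I z b)
    (h : ∀ q, G.π (x q) = R.π (z q)) :
    ∃ (y : T → K.X) (h₁ : ∀ q, G.π (x q) = K.π (y q)) (h₂ : ∀ q, K.π (y q) = R.π (z q))
      (a : ∀ q, f.fib (h₁ q)) (c : ∀ q, g.fib (h₂ q)), f.Smooth J a b ∧ g.Smooth J c b := by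
  obtain ⟨y, e, hy⟩ := G.exists_smooth_lift K.toLocallySplit hx
  obtain ⟨a, ha⟩ := f.exists_smooth hx hy e
  obtain ⟨c, hc⟩ := g.exists_smooth hy hz fun q => (e q).symm.trans (h q)
  exact ⟨y, _, _, a, c, ha, hc⟩

variable {f g} in
theorem smooth_compL_lact {hz : ∀ q, R.π (z q) = R.π (z' q)} {r : ∀ q, R.fib (hz q)}
    {t : ∀ q, CompFib f g (h q)} (hr : R.Smooth J r b)
    (ht : SmoothAlong J (compL f g) (fun q => ⟨(x q, z q), h q⟩) t b) :
    SmoothAlong J (compL f g) (fun q => ⟨(x q, z' q), (h q).trans (hz q)⟩)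
      (fun q => CompFib.lact (r q) (t q)) b := by
  obtain ⟨y, h₁, h₂, a, c, ha, hc⟩ :=
    exists_smooth_compL_pair (f := f) (g := g) ht.base.fst ht.base.snd h
  exact SmoothAlong.map (Φ := fun q t => CompFib.lact (h := h q) (r q) t)
    (fun q d t => CompFib.lact_smul d (r q) t) (smooth_compL_pair ha hc)
    ((smooth_compL_pair ha (Smooth.lact hr hc)).congr fun q => (lact_pair (r q) _ _).symm) ht

variable {f g} in
theorem smooth_compL_ract {hx : ∀ q, G.π (x' q) = G.π (x q)} {p : ∀ q, G.fib (hx q)}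
    {t : ∀ q, CompFib f g (h q)} (ht : SmoothAlong J (compL f g) (fun q => ⟨(x q, z q), h q⟩) t b)
    (hp : G.Smooth J p b) :
    SmoothAlong J (compL f g) (fun q => ⟨(x' q, z q), (hx q).trans (h q)⟩)
      (fun q => CompFib.ract (t q) (p q)) b := by
  obtain ⟨y, h₁, h₂, a, c, ha, hc⟩ :=
    exists_smooth_compL_pair (f := f) (g := g) ht.base.fst ht.base.snd h
  exact SmoothAlong.map (Φ := fun q t => CompFib.ract (h := h q) t (p q))
    (fun q d t => CompFib.smul_ract d t (p q)) (smooth_compL_pair ha hc)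
    ((smooth_compL_pair (ha.ract hp) hc).congr fun q => (pair_ract _ _ (p q)).symm) ht

end

/-- The bimodule of the composite. -/
def compBimodule : Bimodule G R where
  L := compL f g
  lact {_ _ _ h _} r t := CompFib.lact (h := h) r t
  ract {_ _ _ h _} t p := CompFib.ract (h := h) t p
  lact_smul {_ _ _ h _} d r t := CompFib.lact_smul (h := h) d r t
  smul_lact {_ _ _ h _} d r t := CompFib.smul_lact (h := h) d r t
  smul_ract {_ _ _ h _} d t p := CompFib.smul_ract (h := h) d t p
  ract_smul {_ _ _ h _} d t p := CompFib.ract_smul (h := h) d t p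
  lact_lact {_ _ _ _ h _ _} r' r t := CompFib.lact_lact (h := h) r' r t
  ract_ract {_ _ _ _ h _ _} t p' p := CompFib.ract_ract (h := h) t p' p
  lact_ract {_ _ _ _ h _ _} r t p := CompFib.lact_ract (h := h) r t p
  one_lact {_ _ h} t := CompFib.one_lact (h := h) t
  ract_one {_ _ h} t := CompFib.ract_one (h := h) t
  smooth_lact hr ht := smooth_compL_lact hr ht
  smooth_ract ht hp := smooth_compL_ract ht hp

/-- The composite `g ∘ f` of stable morphisms. -/
def comp : StableMorphism G R := (compBimodule f g).toStableMorphism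

/-! ### Elements of the composite -/

section Elements

variable {f g} {x : G.X} {y y' : K.X} {z : R.X} {h₁ : G.π x = K.π y} {h₂ : K.π y = R.π z}

/-- The element of `L_(g ∘ f)(x, z)` given by elements of `L_f(x, y)` and of `L_g(y, z)`. -/
def compMk (a : f.fib h₁) (c : g.fib h₂) : (comp f g).fib (h₁.trans h₂) := pair a c

theorem compMk_smul (d : ℂˣ) (a : f.fib h₁) (c : g.fib h₂) :
    compMk a (d • c) = d • compMk a c := pair_smul d a c

theorem smul_compMk (d : ℂˣ) (a : f.fib h₁) (c : g.fib h₂) :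
    compMk (d • a) c = d • compMk a c := smul_pair d a c

theorem compMk_lact {hy : K.π y = K.π y'} {h₂ : K.π y' = R.π z} (q : K.fib hy) (a : f.fib h₁)
    (c : g.fib h₂) : compMk (f.lact q a) c = compMk a (g.ract c q) := pair_lact q a c

theorem exists_eq_compMk {h : G.π x = R.π z} (t : (comp f g).fib h) :
    ∃ (y : K.X) (h₁ : G.π x = K.π y) (h₂ : K.π y = R.π z) (a : f.fib h₁) (c : g.fib h₂),
      t = compMk a c := exists_eq_pair (h := h) t

theorem lact_compMk {z' : R.X} {hz : R.π z = R.π z'} (r : R.fib hz) (a : f.fib h₁)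
    (c : g.fib h₂) : (comp f g).lact r (compMk a c) = compMk a (g.lact r c) :=
  ((compBimodule f g).toStableMorphism_lact r _).trans (lact_pair r a c)

theorem ract_compMk {x' : G.X} {hx : G.π x' = G.π x} (a : f.fib h₁) (c : g.fib h₂)
    (p : G.fib hx) : (comp f g).ract (compMk a c) p = compMk (f.ract a p) c :=
  ((compBimodule f g).toStableMorphism_ract _ p).trans (pair_ract a c p)

theorem Smooth.compMk {x : T → G.X} {y : T → K.X} {z : T → R.X}
    {h₁ : ∀ q, G.π (x q) = K.π (y q)} {h₂ : ∀ q, K.π (y q) = R.π (z q)}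
    {a : ∀ q, f.fib (h₁ q)} {c : ∀ q, g.fib (h₂ q)}
    (ha : f.Smooth J a b) (hc : g.Smooth J c b) :
    (comp f g).Smooth J (fun q => compMk (a q) (c q)) b :=
  smooth_compL_pair ha hc

end Elements

/-- A map out of the fibres of `L_(g ∘ f)` that commutes with the actions. -/
structure Balanced (k : StableMorphism G R) where
  map {x : G.X} {y : K.X} {z : R.X} {h₁ : G.π x = K.π y} {h₂ : K.π y = R.π z} (a : f.fib h₁)
    (c : g.fib h₂) : k.fib (h₁.trans h₂)
  map_lact {x : G.X} {y y' : K.X} {z : R.X} {h₁ : G.π x = K.π y} {hy : K.π y = K.π y'}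
    {h₂ : K.π y' = R.π z} (q : K.fib hy) (a : f.fib h₁) (c : g.fib h₂) :
    map (f.lact q a) c = map a (g.ract c q)
  lact_map {x : G.X} {y : K.X} {z z' : R.X} {h₁ : G.π x = K.π y} {h₂ : K.π y = R.π z}
    {hz : R.π z = R.π z'} (r : R.fib hz) (a : f.fib h₁) (c : g.fib h₂) :
    map a (g.lact r c) = k.lact r (map a c)
  ract_map {x x' : G.X} {y : K.X} {z : R.X} {h₁ : G.π x = K.π y} {h₂ : K.π y = R.π z}
    {hx : G.π x' = G.π x} (a : f.fib h₁) (c : g.fib h₂) (p : G.fib hx) :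
    map (f.ract a p) c = k.ract (map a c) p
  smooth {x : G.fp R.toLocallySplit → G.X} {y : G.fp R.toLocallySplit → K.X}
    {z : G.fp R.toLocallySplit → R.X} {h₁ : ∀ q, G.π (x q) = K.π (y q)}
    {h₂ : ∀ q, K.π (y q) = R.π (z q)} {a : ∀ q, f.fib (h₁ q)} {c : ∀ q, g.fib (h₂ q)}
    {b : G.fp R.toLocallySplit} : f.Smooth (G.I.prod R.I) a b → g.Smooth (G.I.prod R.I) c b →
    k.Smooth (G.I.prod R.I) (fun q => map (a q) (c q)) b

variable {f g} {k : StableMorphism G R}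

/-- The map on fibres given by a balanced map. -/
def Balanced.descMap (F : Balanced f g k) {x : G.X} {z : R.X} (h : G.π x = R.π z)
    (t : (comp f g).fib h) : k.fib h :=
  CompFib.desc h (fun h₁ h₂ a c => F.map (h₁ := h₁) (h₂ := h₂) a c)
    (fun _ _ _ q a c => F.map_lact q a c) t

theorem Balanced.descMap_compMk (F : Balanced f g k) {x : G.X} {y : K.X} {z : R.X}
    {h₁ : G.π x = K.π y} {h₂ : K.π y = R.π z} (a : f.fib h₁) (c : g.fib h₂) :
    F.descMap (h₁.trans h₂) (compMk a c) = F.map a c :=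
  desc_pair (fun _ _ _ q a c => F.map_lact q a c) a c

theorem Balanced.descMap_lact (F : Balanced f g k) {x : G.X} {z z' : R.X} {h : G.π x = R.π z}
    {hz : R.π z = R.π z'} (r : R.fib hz) (t : (comp f g).fib h) :
    F.descMap (h.trans hz) ((comp f g).lact r t) = k.lact r (F.descMap h t) := by
  obtain ⟨y, h₁, h₂, a, c, rfl⟩ := exists_eq_compMk t
  rw [lact_compMk, F.descMap_compMk, F.descMap_compMk, F.lact_map]

theorem Balanced.descMap_ract (F : Balanced f g k) {x x' : G.X} {z : R.X} {h : G.π x = R.π z}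
    {hx : G.π x' = G.π x} (t : (comp f g).fib h) (p : G.fib hx) :
    F.descMap (hx.trans h) ((comp f g).ract t p) = k.ract (F.descMap h t) p := by
  obtain ⟨y, h₁, h₂, a, c, rfl⟩ := exists_eq_compMk t
  rw [ract_compMk, F.descMap_compMk, F.descMap_compMk, F.ract_map]

theorem Balanced.descMap_smul (F : Balanced f g k) {x : G.X} {z : R.X} (h : G.π x = R.π z)
    (d : ℂˣ) (t : (comp f g).fib h) : F.descMap h (d • t) = d • F.descMap h t := by
  have e := F.descMap_ract t (d • G.one x)
  rwa [ract_smul, ract_one, ract_smul, ract_one] at e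

/-- The transformation `g ∘ f ⇒ k` given by a balanced map. -/
def Balanced.desc (F : Balanced f g k) : comp f g ⟶ k :=
  ofIso (.ofExists (fun b => F.descMap b.2) (fun b => F.descMap_smul b.2)
    fun b => by
      have hb := SmoothMapAt.val (J := G.I.prod R.I) (p := b)
      obtain ⟨y, h₁, h₂, a, c, ha, hc⟩ :=
        exists_smooth_compL_pair (f := f) (g := g) hb.fst hb.snd fun q => q.2
      exact ⟨_, ha.compMk hc, (F.smooth ha hc).congr fun q => (F.descMap_compMk _ _).symm⟩)
    (fun _ _ r t => F.descMap_lact r t) (fun _ _ t p => F.descMap_ract t p)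

theorem Balanced.app_desc (F : Balanced f g k) {x : G.X} {y : K.X} {z : R.X} {h₁ : G.π x = K.π y}
    {h₂ : K.π y = R.π z} (a : f.fib h₁) (c : g.fib h₂) :
    app F.desc (compMk a c) = F.map a c :=
  (app_ofIso _ _ (compMk a c)).trans (F.descMap_compMk a c)

theorem comp_hom_ext {s t : comp f g ⟶ k} (e : ∀ {x : G.X} {y : K.X} {z : R.X}
    {h₁ : G.π x = K.π y} {h₂ : K.π y = R.π z} (a : f.fib h₁) (c : g.fib h₂),
    app s (compMk a c) = app t (compMk a c)) : s = t :=
  hom_ext fun _ _ h =>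
    let ⟨_, _, _, a, c, _⟩ := exists_eq_compMk (Classical.arbitrary ((comp f g).fib h))
    ⟨compMk a c, e a c⟩

/-! ## Identities -/

/-- The bimodule `P` of the identity. -/
def idBimodule (G : BundleGerbe E M) : Bimodule G G where
  L := G.P
  lact q a := G.mul q a
  ract a p := G.mul a p
  lact_smul c q a := G.mul_smul c q a
  smul_lact c q a := G.smul_mul c q a
  smul_ract c a p := G.smul_mul c a p
  ract_smul c a p := G.mul_smul c a p
  lact_lact q' q a := (G.mul_assoc q' q a).symm
  ract_ract a p' p := G.mul_assoc a p' p
  lact_ract q a p := (G.mul_assoc q a p).symm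
  one_lact a := G.one_mul a
  ract_one a := G.mul_one a
  smooth_lact hq ha := hq.mul ha
  smooth_ract ha hp := BundleGerbe.Smooth.mul ha hp

/-- The identity stable morphism. -/
def identity (G : BundleGerbe E M) : StableMorphism G G := (idBimodule G).toStableMorphism

/-- An element of `P` as an element of the bundle of the identity. -/
def idMk {G : BundleGerbe E M} {x y : G.X} {h : G.π x = G.π y} (v : G.fib h) :
    (identity G).fib h := v

/-- The element of `P` underlying an element of the bundle of the identity. -/
def idVal {G : BundleGerbe E M} {x y : G.X} {h : G.π x = G.π y} (v : (identity G).fib h) :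
    G.fib h := v

theorem idVal_idMk {G : BundleGerbe E M} {x y : G.X} {h : G.π x = G.π y}
    (v : G.fib h) : idVal (idMk v) = v := rfl

theorem identity_lact {G : BundleGerbe E M} {x y y' : G.X} {h : G.π x = G.π y}
    {hy : G.π y = G.π y'} (q : G.fib hy) (v : (identity G).fib h) :
    (identity G).lact q v = idMk (G.mul q (idVal v)) :=
  (idBimodule G).toStableMorphism_lact q v

theorem identity_ract {G : BundleGerbe E M} {x x' y : G.X} {h : G.π x = G.π y}
    {hx : G.π x' = G.π x} (v : (identity G).fib h) (p : G.fib hx) :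
    (identity G).ract v p = idMk (G.mul (idVal v) p) :=
  (idBimodule G).toStableMorphism_ract v p

theorem Smooth.idVal {G : BundleGerbe E M} {x y : T → G.X} {h : ∀ q, G.π (x q) = G.π (y q)}
    {v : ∀ q, (identity G).fib (h q)} (hv : (identity G).Smooth J v b) :
    G.Smooth J (fun q => idVal (v q)) b := hv

theorem smooth_idMk {G : BundleGerbe E M} {x y : T → G.X} {h : ∀ q, G.π (x q) = G.π (y q)}
    {v : ∀ q, G.fib (h q)} (hv : G.Smooth J v b) :
    (identity G).Smooth J (fun q => idMk (v q)) b := hv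

variable {G K R Q : BundleGerbe E M}

/-! ## Whiskering, associators and unitors -/

/-- Horizontal composition with an identity on the left. -/
def whiskerLeft (f : StableMorphism G K) {g g' : StableMorphism K R} (ρ : g ⟶ g') :
    comp f g ⟶ comp f g' :=
  Balanced.desc
    { map := fun a c => compMk a (app ρ c)
      map_lact := fun q a c => by rw [compMk_lact, app_ract]
      lact_map := fun r a c => by rw [app_lact, lact_compMk]
      ract_map := fun a c p => by rw [ract_compMk]
      smooth := fun ha hc => ha.compMk (hc.app ρ) }

/-- Horizontal composition with an identity on the right. -/
def whiskerRight {f f' : StableMorphism G K} (θ : f ⟶ f') (g : StableMorphism K R) :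
    comp f g ⟶ comp f' g :=
  Balanced.desc
    { map := fun a c => compMk (app θ a) c
      map_lact := fun q a c => by rw [app_lact, compMk_lact]
      lact_map := fun r a c => by rw [lact_compMk]
      ract_map := fun a c p => by rw [app_ract, ract_compMk]
      smooth := fun ha hc => (ha.app θ).compMk hc }

theorem app_whiskerLeft (f : StableMorphism G K) {g g' : StableMorphism K R} (ρ : g ⟶ g')
    {x : G.X} {y : K.X} {z : R.X} {h₁ : G.π x = K.π y} {h₂ : K.π y = R.π z} (a : f.fib h₁)
    (c : g.fib h₂) : app (whiskerLeft f ρ) (compMk a c) = compMk a (app ρ c) :=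
  Balanced.app_desc _ a c

theorem app_whiskerRight {f f' : StableMorphism G K} (θ : f ⟶ f') (g : StableMorphism K R)
    {x : G.X} {y : K.X} {z : R.X} {h₁ : G.π x = K.π y} {h₂ : K.π y = R.π z} (a : f.fib h₁)
    (c : g.fib h₂) : app (whiskerRight θ g) (compMk a c) = compMk (app θ a) c :=
  Balanced.app_desc _ a c

section Associator

variable {f : StableMorphism G K} {g : StableMorphism K R} {k : StableMorphism R Q}
  {x : G.X} {y : K.X} {z : R.X} {t : Q.X}

/-- The map `(a ⊗ b) ⊗ c ↦ a ⊗ (b ⊗ c)`. -/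
def assocMap {h₁ : G.π x = R.π z} {h₂ : R.π z = Q.π t} (l : (comp f g).fib h₁) (c : k.fib h₂) :
    (comp f (comp g k)).fib (h₁.trans h₂) :=
  CompFib.desc (C := (comp f (comp g k)).fib (h₁.trans h₂)) (f := f) (g := g) h₁
    (fun _ _ a b => compMk a (compMk b c))
    (fun _ _ _ q a b => by rw [compMk_lact, ract_compMk]) l

theorem assocMap_compMk {h₁ : G.π x = K.π y} {h₂ : K.π y = R.π z} {h₃ : R.π z = Q.π t}
    (a : f.fib h₁) (b : g.fib h₂) (c : k.fib h₃) :
    assocMap (compMk a b) c = compMk a (compMk b c) :=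
  desc_pair (C := (comp f (comp g k)).fib (h₁.trans (h₂.trans h₃))) (f := f) (g := g)
    (F := fun _ _ a b => compMk a (compMk b c))
    (fun _ _ _ q a b => by rw [compMk_lact, ract_compMk]) a b

theorem assocMap_smul_left {h₁ : G.π x = R.π z} {h₂ : R.π z = Q.π t} (d : ℂˣ)
    (l : (comp f g).fib h₁) (c : k.fib h₂) : assocMap (d • l) c = d • assocMap l c := by
  obtain ⟨y, k₁, k₂, a, b, rfl⟩ := exists_eq_compMk l
  rw [← smul_compMk, assocMap_compMk, assocMap_compMk, smul_compMk]

theorem smooth_assocMap {x : T → G.X} {z : T → R.X} {t : T → Q.X}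
    {h₁ : ∀ q, G.π (x q) = R.π (z q)} {h₂ : ∀ q, R.π (z q) = Q.π (t q)}
    {l : ∀ q, (comp f g).fib (h₁ q)} {c : ∀ q, k.fib (h₂ q)} (hl : (comp f g).Smooth J l b)
    (hc : k.Smooth J c b) : (comp f (comp g k)).Smooth J (fun q => assocMap (l q) (c q)) b := by
  obtain ⟨y, _, _, a, m, ha, hm⟩ :=
    exists_smooth_compL_pair (f := f) (g := g) hl.base.fst hl.base.snd h₁
  exact SmoothAlong.map (L' := (comp f (comp g k)).L)
    (Φ := fun q l => assocMap l (c q)) (fun q d l => assocMap_smul_left d l (c q))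
    (ha.compMk hm) ((ha.compMk (hm.compMk hc)).congr fun q => (assocMap_compMk _ _ _).symm) hl

variable (f g k) in
/-- The associativity transformation. -/
def assocHom : comp (comp f g) k ⟶ comp f (comp g k) :=
  Balanced.desc
    { map := fun l c => assocMap l c
      map_lact := fun q l c => by
        obtain ⟨y, k₁, k₂, a, b, rfl⟩ := exists_eq_compMk l
        rw [lact_compMk, assocMap_compMk, assocMap_compMk, compMk_lact]
      lact_map := fun r l c => by
        obtain ⟨y, k₁, k₂, a, b, rfl⟩ := exists_eq_compMk l
        rw [assocMap_compMk, assocMap_compMk, lact_compMk, lact_compMk]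
      ract_map := fun l c p => by
        obtain ⟨y, k₁, k₂, a, b, rfl⟩ := exists_eq_compMk l
        rw [ract_compMk, assocMap_compMk, assocMap_compMk, ract_compMk]
      smooth := smooth_assocMap }

theorem app_assocHom {h₁ : G.π x = K.π y} {h₂ : K.π y = R.π z} {h₃ : R.π z = Q.π t}
    (a : f.fib h₁) (b : g.fib h₂) (c : k.fib h₃) :
    app (assocHom f g k) (compMk (compMk a b) c) = compMk a (compMk b c) :=
  (Balanced.app_desc _ _ c).trans (assocMap_compMk a b c)

end Associator

/-- The transformation `f ∘ 1 ⇒ f`. -/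
def leftUnitHom (f : StableMorphism G K) : comp (identity G) f ⟶ f :=
  Balanced.desc
    { map := fun v c => f.ract c (idVal v)
      map_lact := fun q v c => by rw [identity_lact, idVal_idMk, ract_ract]
      lact_map := fun r v c => (f.lact_ract r c _).symm
      ract_map := fun v c p => by rw [identity_ract, idVal_idMk, ract_ract]
      smooth := fun hv hc => hc.ract hv.idVal }

/-- The transformation `1 ∘ f ⇒ f`. -/
def rightUnitHom (f : StableMorphism G K) : comp f (identity K) ⟶ f :=
  Balanced.desc
    { map := fun a v => f.lact (idVal v) a
      map_lact := fun q a v => by rw [identity_ract, idVal_idMk, lact_lact]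
      lact_map := fun r a v => by rw [identity_lact, idVal_idMk, lact_lact]
      ract_map := fun a v p => f.lact_ract _ a p
      smooth := fun ha hv => Smooth.lact hv.idVal ha }

theorem app_leftUnitHom (f : StableMorphism G K) {x x' : G.X} {y : K.X} {h₁ : G.π x = G.π x'}
    {h₂ : G.π x' = K.π y} (v : (identity G).fib h₁) (c : f.fib h₂) :
    app (leftUnitHom f) (compMk v c) = f.ract c (idVal v) :=
  Balanced.app_desc _ v c

theorem app_rightUnitHom (f : StableMorphism G K) {x : G.X} {y y' : K.X} {h₁ : G.π x = K.π y}
    {h₂ : K.π y = K.π y'} (a : f.fib h₁) (v : (identity K).fib h₂) :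
    app (rightUnitHom f) (compMk a v) = f.lact (idVal v) a :=
  Balanced.app_desc _ a v

end StableMorphism

open StableMorphism

variable (E M) in
/-- The bicategory of bundle gerbes, stable morphisms and transformations. -/
def stableBicategory : BicategoryOn (StableMorphism (E := E) (M := M)) where
  id := identity
  comp := comp
  whiskerLeft := whiskerLeft
  whiskerRight := whiskerRight
  associator f g k := asIso (assocHom f g k)
  leftUnitor f := asIso (leftUnitHom f)
  rightUnitor f := asIso (rightUnitHom f)
  whiskerLeft_id f g := comp_hom_ext fun a c => by rw [app_whiskerLeft, app_id, app_id]
  whiskerLeft_comp f _ _ _ η θ := comp_hom_ext fun a c => by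
    rw [app_comp, app_whiskerLeft, app_whiskerLeft, app_whiskerLeft, app_comp]
  id_whiskerLeft η := by
    rw [← Category.assoc, Iso.eq_comp_inv]
    refine comp_hom_ext fun a c => ?_
    rw [asIso_hom, asIso_hom, app_comp, app_comp, app_whiskerLeft, app_leftUnitHom,
      app_leftUnitHom, app_ract]
  comp_whiskerLeft f g _ _ η := by
    rw [← Category.assoc, Iso.eq_comp_inv]
    refine comp_hom_ext fun l c => ?_
    obtain ⟨y, k₁, k₂, a, b, rfl⟩ := exists_eq_compMk l
    rw [asIso_hom, asIso_hom, app_comp, app_comp, app_whiskerLeft, app_assocHom, app_assocHom,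
      app_whiskerLeft, app_whiskerLeft]
  id_whiskerRight f g := comp_hom_ext fun a c => by rw [app_whiskerRight, app_id, app_id]
  comp_whiskerRight η θ i := comp_hom_ext fun a c => by
    rw [app_comp, app_whiskerRight, app_whiskerRight, app_whiskerRight, app_comp]
  whiskerRight_id η := by
    rw [← Category.assoc, Iso.eq_comp_inv]
    refine comp_hom_ext fun a c => ?_
    rw [asIso_hom, asIso_hom, app_comp, app_comp, app_whiskerRight, app_rightUnitHom,
      app_rightUnitHom, app_lact]
  whiskerRight_comp η g h := by
    rw [Iso.eq_inv_comp]
    refine comp_hom_ext fun l c => ?_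
    obtain ⟨y, k₁, k₂, a, b, rfl⟩ := exists_eq_compMk l
    rw [asIso_hom, asIso_hom, app_comp, app_comp, app_whiskerRight, app_assocHom,
      app_whiskerRight, app_whiskerRight, app_assocHom]
  whisker_assoc f _ _ η h := by
    rw [← Category.assoc, Iso.eq_comp_inv]
    refine comp_hom_ext fun l c => ?_
    obtain ⟨y, k₁, k₂, a, b, rfl⟩ := exists_eq_compMk l
    rw [asIso_hom, asIso_hom, app_comp, app_comp, app_whiskerRight, app_whiskerLeft,
      app_assocHom, app_assocHom, app_whiskerLeft, app_whiskerRight]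
  whisker_exchange η θ := comp_hom_ext fun a c => by
    rw [app_comp, app_comp, app_whiskerLeft, app_whiskerRight, app_whiskerRight, app_whiskerLeft]
  pentagon f g h i := by
    refine comp_hom_ext fun l d => ?_
    obtain ⟨z, k₁, k₂, l, c, rfl⟩ := exists_eq_compMk l
    obtain ⟨y, k₃, k₄, a, b, rfl⟩ := exists_eq_compMk l
    simp only [asIso_hom, app_comp, app_whiskerRight, app_whiskerLeft, app_assocHom]
  triangle f g := by
    refine comp_hom_ext fun l c => ?_
    obtain ⟨y, k₃, k₄, a, b, rfl⟩ := exists_eq_compMk l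
    rw [asIso_hom, asIso_hom, asIso_hom, app_comp, app_assocHom, app_whiskerRight,
      app_whiskerLeft, app_leftUnitHom, app_rightUnitHom, compMk_lact]

namespace StableMorphism

variable {G K R : BundleGerbe E M}

/-! ## The descent isomorphism of a composite -/

section Glue

variable (f : StableMorphism G K) (g : StableMorphism K R)

/-- The map `L_f(x, y₁) ⊗ L_g(y₂, z) ⊗ Q(y₁, y₂) → L_(g ∘ f)(x, z)`. -/
def glueMap {x : G.X} {y₁ y₂ : K.X} {z : R.X} (h₁ : G.π x = K.π y₁) (h₂ : K.π y₁ = K.π y₂)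
    (h₃ : K.π y₂ = R.π z) :
    TensorTorsor (TensorTorsor (f.fib h₁) (g.fib h₃)) (K.fib h₂) →
      (comp f g).fib (h₁.trans (h₂.trans h₃)) :=
  TensorTorsor.lift
    (fun t q => TensorTorsor.lift (fun a c => compMk (f.lact q a) c)
      (fun d a c => by rw [lact_smul, smul_compMk, compMk_smul]) t)
    (fun d t q => by
      obtain ⟨a, c, rfl⟩ := exists_tmul t
      rw [smul_tmul, lift_tmul, lift_tmul, lact_smul, smul_lact])

theorem glueMap_tmul {x : G.X} {y₁ y₂ : K.X} {z : R.X} {h₁ : G.π x = K.π y₁}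
    {h₂ : K.π y₁ = K.π y₂} {h₃ : K.π y₂ = R.π z} (a : f.fib h₁) (c : g.fib h₃) (q : K.fib h₂) :
    glueMap f g h₁ h₂ h₃ (tmul (tmul a c) q) = compMk (f.lact q a) c := rfl

theorem glueMap_smul {x : G.X} {y₁ y₂ : K.X} {z : R.X} (h₁ : G.π x = K.π y₁)
    (h₂ : K.π y₁ = K.π y₂) (h₃ : K.π y₂ = R.π z) (d : ℂˣ)
    (t : TensorTorsor (TensorTorsor (f.fib h₁) (g.fib h₃)) (K.fib h₂)) :
    glueMap f g h₁ h₂ h₃ (d • t) = d • glueMap f g h₁ h₂ h₃ t := by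
  obtain ⟨t, q, rfl⟩ := exists_tmul t
  obtain ⟨a, c, rfl⟩ := exists_tmul t
  rw [smul_tmul, smul_tmul, glueMap_tmul, glueMap_tmul, lact_smul, smul_compMk]

/-- `comp f g` is a composite of `f` and `g`. -/
def compComposite : Composite f g (comp f g) where
  κ := .ofExists (fun b => glueMap f g b.2.1 b.2.2.1 b.2.2.2)
    (fun b => glueMap_smul f g b.2.1 b.2.2.1 b.2.2.2) fun b => by
    have hb := SmoothMapAt.val (J := G.I.prod (R.I.prod (K.I.prod K.I))) (p := b)
    obtain ⟨a, ha⟩ := f.exists_smooth hb.fst hb.snd.snd.fst fun q => q.2.1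
    obtain ⟨c, hc⟩ := g.exists_smooth hb.snd.snd.snd hb.snd.fst fun q => q.2.2.2
    obtain ⟨s, hs⟩ := K.exists_smooth hb.snd.snd.fst hb.snd.snd.snd fun q => q.2.2.1
    exact ⟨fun q => tmul (tmul (a q) (c q)) (s q),
      SmoothAlong.tmul (SmoothAlong.tmul (SmoothAlong.pullback hb ha) (SmoothAlong.pullback hb hc))
        (SmoothAlong.pullback hb hs),
      SmoothAlong.pullback hb ((Smooth.lact hs ha).compMk hc)⟩
  phi_glue x x' y₁ y₂ y₁' y₂' z z' h₁ h₂ h₃ h₁' h₂' h₃' hx hy₁ hy₂ hz a c q a' c' q' p s t r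
      e₁ e₂ e₃ := by
    replace e₁ := f.phi_eq_iff.1 e₁
    replace e₂ := g.phi_eq_iff.1 e₂
    refine (comp f g).phi_eq_of_ract_eq
      (l₁ := compMk (f.lact q a) c) (l₂ := compMk (f.lact q' a') c') ?_
    rw [ract_compMk, lact_compMk, ← lact_ract, e₁, lact_lact, e₃, ← e₂, ← lact_lact, compMk_lact]

end Glue

/-- `identity G` is an identity of `G`. -/
def identityOn (G : BundleGerbe E M) : IdentityOn G (identity G) where
  ι :=
    { map := fun _ v => v
      map_smul := fun _ _ _ => rfl
      smooth := G.P.smooth_transition }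
  phi_ι x₁ x₂ y₁ y₂ h₁ h₂ hx hy v₁ v₂ p q e :=
    (identity G).phi_eq_of_ract_eq (l₁ := idMk v₁) (l₂ := idMk v₂) (by
      rw [identity_ract, identity_lact, idVal_idMk, idVal_idMk, e])

/-! ## Inverses -/

section Inverse

variable (f : StableMorphism G K)

/-- The bimodule inverse to `L_f`. -/
def invBimodule : Bimodule K G where
  L := (f.L.pullback (K.fp G.toLocallySplit) (fun p => (p.2, p.1))
    (contMDiff_snd.prodMk contMDiff_fst) fun _ h => Eq.symm h).dual
  lact {_ _ _ h _} p l := dstar (f.ract (h := h.symm) l.undstar (G.inv p))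
  ract {_ _ _ h _} l q := dstar (f.lact (h := h.symm) (K.inv q) l.undstar)
  lact_smul {_ _ _ h _} c p l := congrArg dstar (f.smul_ract (h := h.symm) c⁻¹ l.undstar _)
  smul_lact {_ _ _ h _} c p l := congrArg dstar (by rw [G.inv_smul, f.ract_smul (h := h.symm)])
  smul_ract {_ _ _ h _} c l q := congrArg dstar (f.lact_smul (h := h.symm) c⁻¹ _ l.undstar)
  ract_smul {_ _ _ h _} c l q := congrArg dstar (by rw [K.inv_smul, f.smul_lact (h := h.symm)])
  lact_lact {_ _ _ _ h _ _} p' p l := congrArg dstar (by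
    rw [f.ract_ract (h := h.symm), G.inv_mul_rev])
  ract_ract {_ _ _ _ h _ _} l q' q := congrArg dstar (by
    rw [f.lact_lact (h := h.symm), K.inv_mul_rev])
  lact_ract {_ _ _ _ h _ _} p l q := congrArg dstar
    (f.lact_ract (h := h.symm) _ l.undstar _).symm
  one_lact {_ _ h} l := congrArg dstar (by rw [G.inv_one, f.ract_one (h := h.symm)])
  ract_one {_ _ h} l := congrArg dstar (by rw [K.inv_one, f.one_lact (h := h.symm)])
  smooth_lact hp hl := SmoothAlong.dstar (SmoothAlong.pullback (hl.base.fst.prodMk hp.base.snd)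
    (Smooth.ract hl.of_dstar.of_pullback hp.inv))
  smooth_ract hl hq := SmoothAlong.dstar (SmoothAlong.pullback (hq.base.fst.prodMk hl.base.snd)
    (Smooth.lact hq.inv hl.of_dstar.of_pullback))

/-- The stable morphism inverse to `f`. -/
def inverse : StableMorphism K G := (invBimodule f).toStableMorphism

variable {f} {x x' : G.X} {y y' : K.X}

/-- The element of `L_f` underlying an element of the inverse of `f`. -/
def invVal {h : K.π y = G.π x} (l : (inverse f).fib h) : f.fib h.symm := l.undstar

theorem invVal_lact {h : K.π y = G.π x} {hx : G.π x = G.π x'} (p : G.fib hx)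
    (l : (inverse f).fib h) : invVal ((inverse f).lact p l) = f.ract (invVal l) (G.inv p) :=
  congrArg undstar ((invBimodule f).toStableMorphism_lact p l)

theorem invVal_ract {h : K.π y = G.π x} {hy : K.π y' = K.π y} (l : (inverse f).fib h)
    (q : K.fib hy) : invVal ((inverse f).ract l q) = f.lact (K.inv q) (invVal l) :=
  congrArg undstar ((invBimodule f).toStableMorphism_ract l q)

theorem Smooth.invVal {x : T → G.X} {y : T → K.X} {h : ∀ q, K.π (y q) = G.π (x q)}
    {l : ∀ q, (inverse f).fib (h q)} (hl : (inverse f).Smooth J l b) :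
    f.Smooth J (fun q => invVal (l q)) b := by
  have hl' := SmoothAlong.of_dstar
    (L := f.L.pullback (K.fp G.toLocallySplit) (fun p => (p.2, p.1))
      (contMDiff_snd.prodMk contMDiff_fst) fun _ h => Eq.symm h)
    (k := fun q => ⟨(y q, x q), h q⟩) (s := fun q => StableMorphism.invVal (l q)) hl
  exact hl'.of_pullback

/-- The element `p` of `P(x, x')` with `a' p = a`. -/
def rdiv {h : G.π x = K.π y} {h' : G.π x' = K.π y} (a : f.fib h) (a' : f.fib h') :
    G.fib (h.trans h'.symm) :=
  Function.surjInv (f.ract_right_bijective a').2 a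

theorem ract_rdiv {h : G.π x = K.π y} {h' : G.π x' = K.π y} (a : f.fib h) (a' : f.fib h') :
    f.ract a' (rdiv a a') = a :=
  Function.surjInv_eq (f.ract_right_bijective a').2 a

theorem eq_rdiv {h : G.π x = K.π y} {h' : G.π x' = K.π y} {a : f.fib h} {a' : f.fib h'}
    {p : G.fib (h.trans h'.symm)} (e : f.ract a' p = a) : p = rdiv a a' :=
  (f.ract_right_bijective a').1 (e.trans (ract_rdiv a a').symm)

theorem rdiv_ract {x'' : G.X} {h : G.π x = K.π y} {h' : G.π x' = K.π y} {hx : G.π x'' = G.π x}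
    (a : f.fib h) (p : G.fib hx) (a' : f.fib h') :
    rdiv (f.ract a p) a' = G.mul (rdiv a a') p :=
  (eq_rdiv (by rw [← ract_ract, ract_rdiv])).symm

theorem rdiv_ract_inv {x'' : G.X} {h : G.π x = K.π y} {h' : G.π x' = K.π y}
    {hx : G.π x' = G.π x''} (a : f.fib h) (a' : f.fib h') (p : G.fib hx) :
    rdiv a (f.ract a' (G.inv p)) = G.mul p (rdiv a a') :=
  (eq_rdiv (by rw [ract_ract, G.inv_mul_cancel_left, ract_rdiv])).symm

theorem rdiv_lact {h : G.π x = K.π y} {h' : G.π x' = K.π y'} {hy : K.π y = K.π y'} (q : K.fib hy)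
    (a : f.fib h) (a' : f.fib h') : rdiv (f.lact q a) a' = rdiv a (f.lact (K.inv q) a') :=
  (eq_rdiv (a' := a') (by
    have e := congrArg (f.lact q) (ract_rdiv a (f.lact (K.inv q) a'))
    rwa [lact_ract, lact_lact, K.mul_inv, one_lact] at e)).symm

/-- The element `q` of `Q(y, y')` with `q a = a'`. -/
def ldiv {h : G.π x = K.π y} {h' : G.π x = K.π y'} (a : f.fib h) (a' : f.fib h') :
    K.fib (h.symm.trans h') :=
  Function.surjInv (f.lact_left_bijective a).2 a'

theorem ldiv_lact {h : G.π x = K.π y} {h' : G.π x = K.π y'} (a : f.fib h) (a' : f.fib h') :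
    f.lact (ldiv a a') a = a' :=
  Function.surjInv_eq (f.lact_left_bijective a).2 a'

theorem eq_ldiv {h : G.π x = K.π y} {h' : G.π x = K.π y'} {a : f.fib h} {a' : f.fib h'}
    {q : K.fib (h.symm.trans h')} (e : f.lact q a = a') : q = ldiv a a' :=
  (f.lact_left_bijective a).1 (e.trans (ldiv_lact a a').symm)

theorem ldiv_lact_right {y'' : K.X} {h : G.π x = K.π y} {h' : G.π x = K.π y'}
    {hy : K.π y' = K.π y''} (a : f.fib h) (q : K.fib hy) (a' : f.fib h') :
    ldiv a (f.lact q a') = K.mul q (ldiv a a') :=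
  (eq_ldiv (by rw [← lact_lact, ldiv_lact])).symm

theorem ldiv_lact_inv {y'' : K.X} {h : G.π x = K.π y} {h' : G.π x = K.π y'}
    {hy : K.π y'' = K.π y} (q : K.fib hy) (a : f.fib h) (a' : f.fib h') :
    ldiv (f.lact (K.inv q) a) a' = K.mul (ldiv a a') q :=
  (eq_ldiv (by rw [lact_lact, K.mul_assoc, K.mul_inv, K.mul_one, ldiv_lact])).symm

theorem ldiv_ract {h : G.π x = K.π y} {h' : G.π x' = K.π y'} {hx : G.π x = G.π x'} (a : f.fib h)
    (a' : f.fib h') (p : G.fib hx) : ldiv (f.ract a (G.inv p)) a' = ldiv a (f.ract a' p) :=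
  eq_ldiv (a := a) (by
    have e := congrArg (f.ract · p) (ldiv_lact (f.ract a (G.inv p)) a')
    rwa [← lact_ract, ract_ract, G.inv_mul, ract_one] at e)

theorem Smooth.rdiv {x x' : T → G.X} {y : T → K.X} {h : ∀ q, G.π (x q) = K.π (y q)}
    {h' : ∀ q, G.π (x' q) = K.π (y q)} {a : ∀ q, f.fib (h q)} {a' : ∀ q, f.fib (h' q)}
    (ha : f.Smooth J a b) (ha' : f.Smooth J a' b) :
    G.Smooth J (fun q => rdiv (a q) (a' q)) b := by
  refine SmoothAlong.of_map (L' := f.L) (Φ := fun q p => f.ract (a' q) p)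
    (fun q c p => f.ract_smul c (a' q) p) (fun t ht => Smooth.ract ha' ht)
    (ha.base.fst.prodMk ha'.base.fst) ?_
  exact ha.congr fun q => (ract_rdiv (a q) (a' q)).symm

theorem Smooth.ldiv {x : T → G.X} {y y' : T → K.X} {h : ∀ q, G.π (x q) = K.π (y q)}
    {h' : ∀ q, G.π (x q) = K.π (y' q)} {a : ∀ q, f.fib (h q)} {a' : ∀ q, f.fib (h' q)}
    (ha : f.Smooth J a b) (ha' : f.Smooth J a' b) :
    K.Smooth J (fun q => ldiv (a q) (a' q)) b := by
  refine SmoothAlong.of_map (L' := f.L) (Φ := fun q p => f.lact p (a q))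
    (fun q c p => f.smul_lact c p (a q)) (fun t ht => Smooth.lact ht ha)
    (ha.base.snd.prodMk ha'.base.snd) ?_
  exact ha'.congr fun q => (ldiv_lact (a q) (a' q)).symm

variable (f)

/-- The transformation `f⁻¹ ∘ f ⇒ 1`. -/
def compInverseHom : comp f (inverse f) ⟶ identity G :=
  Balanced.desc
    { map := fun a l => idMk (rdiv a (invVal l))
      map_lact := fun q a l => by rw [invVal_ract, rdiv_lact]
      lact_map := fun r a l => by rw [identity_lact, idVal_idMk, invVal_lact, rdiv_ract_inv]
      ract_map := fun a l p => by rw [identity_ract, idVal_idMk, rdiv_ract]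
      smooth := fun ha hl => smooth_idMk (Smooth.rdiv ha hl.invVal) }

/-- The transformation `f ∘ f⁻¹ ⇒ 1`. -/
def inverseCompHom : comp (inverse f) f ⟶ identity K :=
  Balanced.desc
    { map := fun l a => idMk (ldiv (invVal l) a)
      map_lact := fun p l a => by rw [invVal_lact, ldiv_ract]
      lact_map := fun r l a => by rw [identity_lact, idVal_idMk, ldiv_lact_right]
      ract_map := fun l a q => by rw [identity_ract, idVal_idMk, invVal_ract, ldiv_lact_inv]
      smooth := fun hl ha => smooth_idMk (Smooth.ldiv hl.invVal ha) }

variable {f}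

theorem app_compInverseHom {h : G.π x = K.π y} {h' : K.π y = G.π x'} (a : f.fib h)
    (l : (inverse f).fib h') : app (compInverseHom f) (compMk a l) = idMk (rdiv a (invVal l)) :=
  Balanced.app_desc _ a l

theorem app_inverseCompHom {h : K.π y = G.π x} {h' : G.π x = K.π y'} (l : (inverse f).fib h)
    (a : f.fib h') : app (inverseCompHom f) (compMk l a) = idMk (ldiv (invVal l) a) :=
  Balanced.app_desc _ l a

variable (f)

theorem inverse_coherence : whiskerRight (compInverseHom f) f ≫ leftUnitHom f =
    assocHom f (inverse f) f ≫ whiskerLeft f (inverseCompHom f) ≫ rightUnitHom f := by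
  refine comp_hom_ext fun l c => ?_
  obtain ⟨y, k₁, k₂, a, l, rfl⟩ := exists_eq_compMk l
  rw [app_comp, app_comp, app_comp, app_assocHom, app_whiskerRight, app_whiskerLeft,
    app_compInverseHom, app_inverseCompHom, app_leftUnitHom, app_rightUnitHom, idVal_idMk,
    idVal_idMk]
  conv_lhs => rw [← ldiv_lact (invVal l) c]
  rw [← lact_ract, ract_rdiv]

end Inverse

end StableMorphism

variable (E M) in
/-- The operations of `stableBicategory` are the ones of the theory of bundle gerbes. -/
def stableOperations : StableOperations (stableBicategory E M) where
  composite f g := compComposite f g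
  identity G := identityOn G
  whiskerLeft_value f g g' ρ x y₁ y₂ z h₁ h₂ h₃ a c c' q e := by
    refine value_eq_iff.2 ((app_whiskerLeft f ρ (f.lact q a) c).trans ?_)
    rw [value_eq_iff.1 e]
    rfl
  whiskerRight_value f f' g θ x y₁ y₂ z h₁ h₂ h₃ a a' c q e := by
    refine value_eq_iff.2 ((app_whiskerRight θ g (f.lact q a) c).trans ?_)
    rw [app_lact, value_eq_iff.1 e]
    rfl
  associator_value f g k x y₁ y₂ z₁ z₂ t h₁ h₂ h₃ h₄ h₅ a b c q r := by
    refine value_eq_iff.2 ?_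
    change app (assocHom f g k) (compMk ((comp f g).lact r (compMk (f.lact q a) b)) c) =
      compMk (f.lact q a) (compMk (g.lact r b) c)
    rw [lact_compMk, app_assocHom]
  leftUnitor_value {G K} f x x₁ x₂ y h₁ h₂ h₃ v c q a e he e₁ := by
    refine value_eq_iff.2 ?_
    change app (leftUnitHom f) (compMk ((identity G).lact q (idMk v)) c) = a
    rw [app_leftUnitHom, identity_lact, idVal_idMk, idVal_idMk, f.phi_eq_iff.1 e₁, K.eq_one he,
      one_lact]
  rightUnitor_value {G K} f x y₁ y₂ y h₁ h₂ h₃ a v q a' e he e₁ := by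
    refine value_eq_iff.2 ?_
    change app (rightUnitHom f) (compMk (f.lact q a) (idMk v)) = a'
    rw [app_rightUnitHom, idVal_idMk, lact_lact, ← f.phi_eq_iff.1 e₁, G.eq_one he, ract_one]

variable (E M) in
theorem isBigroupoid_stableBicategory :
    @IsBigroupoid (BundleGerbe E M) (stableBicategory E M).toBicategory := by
  refine ⟨fun G K f g s => isIso (f := f) (g := g) s, fun G K f =>
    ⟨inverse f, compInverseHom f, inverseCompHom f, ?_⟩⟩
  exact ((asIso (assocHom f (inverse f) f)).inv_comp_eq).2 (inverse_coherence f)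

end

theorem mainTheorem10 (E M : Type u) [NormedAddCommGroup E] [NormedSpace ℝ E] [TopologicalSpace M]
    [ChartedSpace E M] [IsManifold 𝓘(ℝ, E) ∞ M] :
    ∃ 𝔅 : BicategoryOn (StableMorphism (E := E) (M := M)),
      Nonempty (StableOperations 𝔅) ∧ @IsBigroupoid (BundleGerbe E M) 𝔅.toBicategory :=
  ⟨stableBicategory E M, ⟨stableOperations E M⟩, isBigroupoid_stableBicategory E M⟩
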